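/- Work in the language of second-order arithmetic, with number variables, set variables, $0,1,+,\cdot,<,=$ and $\in$. The system $\mathbf{RCA}_0$ consists of the usual basic axioms for $0,1,+,\cdot,<$, of $\Sigma^0_1$-induction and of $\Delta^0_1$-comprehension (both schemes with number and set parameters). As usual, a binary relation on $\mathbb N$ is coded by the set of codes $(m+n)^2+m$ of its pairs $(m,n)$. A (countable) linear order $X$ is a set coding a relation $\leq_X$ that is antisymmetric, transitive and total on its field $\{n : n\leq_X n\}$, where $m\leq_X n$ implies that $m$ and $n$ lie in the field. We write $m<_X n$ for $m\leq_X n$ and $m\neq n$. A linear order $X$ is a *well order* if there is no function $f:\mathbb N\to X$ with $f(n+1)<_X f(n)$ for all $n$. An *initial segment* of $X$ is a set $I\subseteq X$ such that $x<_X y$ and $y\in I$ imply $x\in I$. A linear order $X$ is a *weak well order* if there are no initial segments $I_0\subsetneq I$ of $X$ with an embedding $f:I\to I_0$, i.e. a function such that $x<_X y$ implies $f(x)<_X f(y)$. **Corollary.** Over $\mathbf{RCA}_0$, the statement that every weak well order is a well order implies arithmetical comprehension. That is, each instance $$\exists X\,\forall n\,(n\in X\leftrightarrow\varphi(n)),$$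 where $\varphi$ is a formula without set quantifiers, possibly with number and set parameters other than $X$, is a logical consequence of the axioms of $\mathbf{RCA}_0$ together with the sentence "every weak well order is a well order". In other words, the universal closure of each instance is true in every structure for the two-sorted language (with arbitrary, possibly nonstandard, first-order part, and with an arbitrary collection of subsets as range of the set variables) in which $\mathbf{RCA}_0$ and this sentence are true. -/

import Mathlib

/-!
Second-order arithmetic: the two-sorted language with number and set variables, its structures and
satisfaction relation, the axioms of `RCA₀`, the arithmetical comprehension scheme, and the
formalization of countable linear orders, well orders and weak well orders in this language.
-/

universe u

namespace SOA

/-! ### The language -/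

/-- Numerical terms in `n` free number variables. -/
inductive Term (n : ℕ) : Type
  | var (i : Fin n) : Term n
  | zero : Term n
  | one : Term n
  | add (s t : Term n) : Term n
  | mul (s t : Term n) : Term n

instance (n : ℕ) : Zero (Term n) := ⟨Term.zero⟩
instance (n : ℕ) : One (Term n) := ⟨Term.one⟩
instance (n : ℕ) : Add (Term n) := ⟨Term.add⟩
instance (n : ℕ) : Mul (Term n) := ⟨Term.mul⟩

/-- Formulas with `n` free number variables and `k` free set variables.  A quantifier binds the
variable with index `0` of its sort; the indices of the other variables of that sort go up by one
below the quantifier. -/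
inductive Formula : ℕ → ℕ → Type
  | eq {n k : ℕ} (s t : Term n) : Formula n k
  | lt {n k : ℕ} (s t : Term n) : Formula n k
  | mem {n k : ℕ} (t : Term n) (X : Fin k) : Formula n k
  | not {n k : ℕ} (φ : Formula n k) : Formula n k
  | and {n k : ℕ} (φ ψ : Formula n k) : Formula n k
  | or {n k : ℕ} (φ ψ : Formula n k) : Formula n k
  | imp {n k : ℕ} (φ ψ : Formula n k) : Formula n k
  | all {n k : ℕ} (φ : Formula (n + 1) k) : Formula n k
  | ex {n k : ℕ} (φ : Formula (n + 1) k) : Formula n k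
  | allSet {n k : ℕ} (φ : Formula n (k + 1)) : Formula n k
  | exSet {n k : ℕ} (φ : Formula n (k + 1)) : Formula n k

/-- Formulas without free variables. -/
abbrev Sentence : Type := Formula 0 0

/-- Simultaneous substitution of terms for number variables. -/
def Term.subst {n m : ℕ} (σ : Fin n → Term m) : Term n → Term m
  | .var i => σ i
  | .zero => .zero
  | .one => .one
  | .add s t => .add (s.subst σ) (t.subst σ)
  | .mul s t => .mul (s.subst σ) (t.subst σ)

/-- A term, read below one more number quantifier. -/
def Term.lift {n : ℕ} (t : Term n) : Term (n + 1) := t.subst fun i => .var i.succ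

/-- Simultaneous capture-avoiding substitution of terms for number variables and of set variables
for set variables. -/
def Formula.subst : {n m k l : ℕ} → (Fin n → Term m) → (Fin k → Fin l) → Formula n k → Formula m l
  | _, _, _, _, σ, _, .eq s t => .eq (s.subst σ) (t.subst σ)
  | _, _, _, _, σ, _, .lt s t => .lt (s.subst σ) (t.subst σ)
  | _, _, _, _, σ, ρ, .mem t X => .mem (t.subst σ) (ρ X)
  | _, _, _, _, σ, ρ, .not φ => .not (φ.subst σ ρ)
  | _, _, _, _, σ, ρ, .and φ ψ => .and (φ.subst σ ρ) (ψ.subst σ ρ)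
  | _, _, _, _, σ, ρ, .or φ ψ => .or (φ.subst σ ρ) (ψ.subst σ ρ)
  | _, _, _, _, σ, ρ, .imp φ ψ => .imp (φ.subst σ ρ) (ψ.subst σ ρ)
  | _, m, _, _, σ, ρ, .all φ =>
      .all (φ.subst (Fin.cons (.var 0 : Term (m + 1)) fun i => (σ i).lift) ρ)
  | _, m, _, _, σ, ρ, .ex φ =>
      .ex (φ.subst (Fin.cons (.var 0 : Term (m + 1)) fun i => (σ i).lift) ρ)
  | _, _, _, l, σ, ρ, .allSet φ =>
      .allSet (φ.subst σ (Fin.cons (0 : Fin (l + 1)) fun i => (ρ i).succ))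
  | _, _, _, l, σ, ρ, .exSet φ =>
      .exSet (φ.subst σ (Fin.cons (0 : Fin (l + 1)) fun i => (ρ i).succ))

namespace Formula

/-- Biconditional. -/
def iff {n k : ℕ} (φ ψ : Formula n k) : Formula n k := (φ.imp ψ).and (ψ.imp φ)

/-- The bounded quantifier `∀ x < t`, where `x` does not occur in `t`. -/
def ball {n k : ℕ} (t : Term n) (φ : Formula (n + 1) k) : Formula n k :=
  .all ((lt (.var 0) t.lift).imp φ)

/-- The bounded quantifier `∃ x < t`, where `x` does not occur in `t`. -/
def bex {n k : ℕ} (t : Term n) (φ : Formula (n + 1) k) : Formula n k :=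
  .ex ((lt (.var 0) t.lift).and φ)

/-- Universal quantification over all free number variables. -/
def closeNum : {n k : ℕ} → Formula n k → Formula 0 k
  | 0, _, φ => φ
  | _ + 1, _, φ => closeNum (.all φ)

/-- Universal quantification over all free set variables. -/
def closeSet : {n k : ℕ} → Formula n k → Formula n 0
  | _, 0, φ => φ
  | _, _ + 1, φ => closeSet (.allSet φ)

/-- The universal closure. -/
def close {n k : ℕ} (φ : Formula n k) : Sentence := φ.closeNum.closeSet

/-! ### Classes of formulas (number and set parameters are allowed) -/

/-- `Σ⁰₀` formulas: all quantifiers are bounded number quantifiers. -/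
inductive IsSigma00 : {n k : ℕ} → Formula n k → Prop
  | eq {n k : ℕ} (s t : Term n) : IsSigma00 (.eq s t : Formula n k)
  | lt {n k : ℕ} (s t : Term n) : IsSigma00 (.lt s t : Formula n k)
  | mem {n k : ℕ} (t : Term n) (X : Fin k) : IsSigma00 (.mem t X)
  | not {n k : ℕ} {φ : Formula n k} : IsSigma00 φ → IsSigma00 φ.not
  | and {n k : ℕ} {φ ψ : Formula n k} : IsSigma00 φ → IsSigma00 ψ → IsSigma00 (φ.and ψ)
  | or {n k : ℕ} {φ ψ : Formula n k} : IsSigma00 φ → IsSigma00 ψ → IsSigma00 (φ.or ψ)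
  | imp {n k : ℕ} {φ ψ : Formula n k} : IsSigma00 φ → IsSigma00 ψ → IsSigma00 (φ.imp ψ)
  | ball {n k : ℕ} (t : Term n) {φ : Formula (n + 1) k} : IsSigma00 φ → IsSigma00 (φ.ball t)
  | bex {n k : ℕ} (t : Term n) {φ : Formula (n + 1) k} : IsSigma00 φ → IsSigma00 (φ.bex t)

/-- `Σ⁰₁` formulas `∃ m θ` with `θ` in `Σ⁰₀`. -/
def IsSigma01 {n k : ℕ} (φ : Formula n k) : Prop :=
  ∃ θ : Formula (n + 1) k, θ.IsSigma00 ∧ φ = .ex θ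

/-- `Π⁰₁` formulas `∀ m θ` with `θ` in `Σ⁰₀`. -/
def IsPi01 {n k : ℕ} (φ : Formula n k) : Prop :=
  ∃ θ : Formula (n + 1) k, θ.IsSigma00 ∧ φ = .all θ

/-- Arithmetical formulas: no set quantifiers. -/
inductive IsArithmetical : {n k : ℕ} → Formula n k → Prop
  | eq {n k : ℕ} (s t : Term n) : IsArithmetical (.eq s t : Formula n k)
  | lt {n k : ℕ} (s t : Term n) : IsArithmetical (.lt s t : Formula n k)
  | mem {n k : ℕ} (t : Term n) (X : Fin k) : IsArithmetical (.mem t X)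
  | not {n k : ℕ} {φ : Formula n k} : IsArithmetical φ → IsArithmetical φ.not
  | and {n k : ℕ} {φ ψ : Formula n k} :
      IsArithmetical φ → IsArithmetical ψ → IsArithmetical (φ.and ψ)
  | or {n k : ℕ} {φ ψ : Formula n k} :
      IsArithmetical φ → IsArithmetical ψ → IsArithmetical (φ.or ψ)
  | imp {n k : ℕ} {φ ψ : Formula n k} :
      IsArithmetical φ → IsArithmetical ψ → IsArithmetical (φ.imp ψ)
  | all {n k : ℕ} {φ : Formula (n + 1) k} : IsArithmetical φ → IsArithmetical φ.all
  | ex {n k : ℕ} {φ : Formula (n + 1) k} : IsArithmetical φ → IsArithmetical φ.ex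

end Formula

/-! ### Structures and logical consequence -/

/-- Structures for the language: an arbitrary first-order part (not necessarily the standard
natural numbers), and a collection of subsets of it over which the set variables range. -/
structure Model : Type (u + 1) where
  carrier : Type u
  zero : carrier
  one : carrier
  add : carrier → carrier → carrier
  mul : carrier → carrier → carrier
  lt : carrier → carrier → Prop
  sets : Set (Set carrier)

/-- The value of a term. -/
def Model.val (M : Model.{u}) {n : ℕ} (v : Fin n → M.carrier) : Term n → M.carrier
  | .var i => v i
  | .zero => M.zero
  | .one => M.one
  | .add s t => M.add (M.val v s) (M.val v t)
  | .mul s t => M.mul (M.val v s) (M.val v t)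

/-- Satisfaction of a formula under an assignment of its free variables. -/
def Model.Sat (M : Model.{u}) :
    {n k : ℕ} → (Fin n → M.carrier) → (Fin k → Set M.carrier) → Formula n k → Prop
  | _, _, v, _, .eq s t => M.val v s = M.val v t
  | _, _, v, _, .lt s t => M.lt (M.val v s) (M.val v t)
  | _, _, v, V, .mem t X => M.val v t ∈ V X
  | _, _, v, V, .not φ => ¬ M.Sat v V φ
  | _, _, v, V, .and φ ψ => M.Sat v V φ ∧ M.Sat v V ψ
  | _, _, v, V, .or φ ψ => M.Sat v V φ ∨ M.Sat v V ψ
  | _, _, v, V, .imp φ ψ => M.Sat v V φ → M.Sat v V ψ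
  | _, _, v, V, .all φ => ∀ a : M.carrier, M.Sat (Fin.cons a v : Fin _ → M.carrier) V φ
  | _, _, v, V, .ex φ => ∃ a : M.carrier, M.Sat (Fin.cons a v : Fin _ → M.carrier) V φ
  | _, _, v, V, .allSet φ => ∀ A ∈ M.sets, M.Sat v (Fin.cons A V : Fin _ → Set M.carrier) φ
  | _, _, v, V, .exSet φ => ∃ A ∈ M.sets, M.Sat v (Fin.cons A V : Fin _ → Set M.carrier) φ

/-- Truth of a sentence in a structure. -/
def Model.Satisfies (M : Model.{u}) (φ : Sentence) : Prop := M.Sat Fin.elim0 Fin.elim0 φ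

/-- Logical consequence: `φ` is true in all structures in which all sentences of `T` are true. -/
def Entails (T : Set Sentence) (φ : Sentence) : Prop :=
  ∀ M : Model.{u}, (∀ ψ ∈ T, M.Satisfies ψ) → M.Satisfies φ

/-! ### Axioms -/

open Formula in
/-- The basic axioms on `0`, `1`, `+`, `·` and `<`. -/
inductive BasicAxiom : Sentence → Prop
  /-- `m + 1 ≠ 0` -/
  | succ_ne_zero : BasicAxiom (.all (.not (.eq (.var 0 + 1) 0)))
  /-- `m + 1 = n + 1 → m = n` -/
  | succ_inj : BasicAxiom
      (.all (.all (.imp (.eq (.var 1 + 1) (.var 0 + 1)) (.eq (.var 1) (.var 0)))))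
  /-- `m + 0 = m` -/
  | add_zero : BasicAxiom (.all (.eq (.var 0 + 0) (.var 0)))
  /-- `m + (n + 1) = (m + n) + 1` -/
  | add_succ : BasicAxiom
      (.all (.all (.eq (.var 1 + (.var 0 + 1)) ((.var 1 + .var 0) + 1))))
  /-- `m · 0 = 0` -/
  | mul_zero : BasicAxiom (.all (.eq (.var 0 * 0) 0))
  /-- `m · (n + 1) = m · n + m` -/
  | mul_succ : BasicAxiom
      (.all (.all (.eq (.var 1 * (.var 0 + 1)) (.var 1 * .var 0 + .var 1))))
  /-- `¬ m < 0` -/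
  | not_lt_zero : BasicAxiom (.all (.not (.lt (.var 0) 0)))
  /-- `m < n + 1 ↔ m < n ∨ m = n` -/
  | lt_succ : BasicAxiom
      (.all (.all (iff (.lt (.var 1) (.var 0 + 1))
        (.or (.lt (.var 1) (.var 0)) (.eq (.var 1) (.var 0))))))

/-- `(φ(0) ∧ ∀ x (φ(x) → φ(x + 1))) → ∀ x φ(x)`, where `x` is the number variable with index `0`
of `φ` and the other free variables are parameters. -/
def inductionFor {n k : ℕ} (φ : Formula (n + 1) k) : Formula n k :=
  ((φ.subst (Fin.cons (0 : Term n) Term.var) id).and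
    (.all (φ.imp (φ.subst (Fin.cons (Term.var 0 + 1 : Term (n + 1)) fun i => .var i.succ) id)))).imp
    (.all φ)

/-- `∃ X ∀ x (x ∈ X ↔ φ(x))`, where `x` is the number variable with index `0` of `φ`, the other
free variables are parameters, and `X` is not free in `φ`. -/
def comprehensionFor {n k : ℕ} (φ : Formula (n + 1) k) : Formula n k :=
  .exSet (.all (Formula.iff (.mem (.var 0) 0) (φ.subst Term.var Fin.succ)))

/-- The axioms of `RCA₀`: the basic axioms, `Σ⁰₁` induction and `Δ⁰₁` comprehension. -/
inductive RCA0 : Set Sentence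
  | basic {φ : Sentence} : BasicAxiom φ → RCA0 φ
  | induction {n k : ℕ} {φ : Formula (n + 1) k} : φ.IsSigma01 → RCA0 (inductionFor φ).close
  | comprehension {n k : ℕ} {φ ψ : Formula (n + 1) k} : φ.IsSigma01 → ψ.IsPi01 →
      RCA0 ((Formula.all (φ.iff ψ)).imp (comprehensionFor φ)).close

/-- The arithmetical comprehension scheme. -/
inductive ArithmeticalComprehension : Set Sentence
  | intro {n k : ℕ} {φ : Formula (n + 1) k} : φ.IsArithmetical →
      ArithmeticalComprehension (comprehensionFor φ).close

/-! ### Orders in second-order arithmetic -/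

/-- The code `(s + t)² + s` of the ordered pair of `s` and `t`. -/
def pair {n : ℕ} (s t : Term n) : Term n := (s + t) * (s + t) + s

/-- `s ≤_X t`.  A binary relation is coded by the set `X` of the codes of its pairs. -/
def ordLe {n k : ℕ} (X : Fin k) (s t : Term n) : Formula n k := .mem (pair s t) X

/-- `s <_X t`. -/
def ordLt {n k : ℕ} (X : Fin k) (s t : Term n) : Formula n k := (ordLe X s t).and (.not (.eq s t))

/-- `t` is an element of the order `X`, that is, of its field. -/
def inField {n k : ℕ} (X : Fin k) (t : Term n) : Formula n k := ordLe X t t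

/-- `X` is a (reflexive) linear order on its field. -/
def linearOrder {n k : ℕ} (X : Fin k) : Formula n k :=
  -- related elements belong to the field
  (Formula.all (.all (.imp (ordLe X (.var 1) (.var 0))
    ((inField X (.var 1)).and (inField X (.var 0)))))).and <|
  -- antisymmetry
  (Formula.all (.all (.imp ((ordLe X (.var 1) (.var 0)).and (ordLe X (.var 0) (.var 1)))
    (.eq (.var 1) (.var 0))))).and <|
  -- transitivity
  (Formula.all (.all (.all (.imp ((ordLe X (.var 2) (.var 1)).and (ordLe X (.var 1) (.var 0)))
    (ordLe X (.var 2) (.var 0)))))).and <|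
  -- totality
  Formula.all (.all (.imp ((inField X (.var 1)).and (inField X (.var 0)))
    ((ordLe X (.var 1) (.var 0)).or (ordLe X (.var 0) (.var 1)))))

/-- `F` is (the graph of) a function from the class `A` to the class `B`. -/
def function {n k : ℕ} (A B : {m : ℕ} → Term m → Formula m k) (F : Fin k) : Formula n k :=
  -- `F ⊆ A × B`
  (Formula.all (.imp (.mem (.var 0) F)
    (.ex (.ex (.and (.eq (.var 2) (pair (.var 1) (.var 0)))
      ((A (.var 1)).and (B (.var 0)))))))).and <|
  -- existence of values
  (Formula.all (.imp (A (.var 0)) (.ex (.mem (pair (.var 1) (.var 0)) F)))).and <|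
  -- uniqueness of values
  Formula.all (.all (.all (.imp
    (.and (.mem (pair (.var 2) (.var 1)) F) (.mem (pair (.var 2) (.var 0)) F))
    (.eq (.var 1) (.var 0)))))

/-- `F` is a descending sequence in `X`: a function from the natural numbers to the field of `X`
with `F(i + 1) <_X F(i)` for all `i`. -/
def descendingSequence {n k : ℕ} (X F : Fin k) : Formula n k :=
  (function (fun t => .eq t t) (fun t => inField X t) F).and <|
  Formula.all (.all (.all (.imp
    (.and (.mem (pair (.var 2) (.var 1)) F) (.mem (pair (.var 2 + 1) (.var 0)) F))
    (ordLt X (.var 0) (.var 1)))))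

/-- `X` is a well order: a linear order without descending sequences. -/
def wellOrder {n k : ℕ} (X : Fin k) : Formula n k :=
  (linearOrder X).and (.not (.exSet (descendingSequence X.succ 0)))

/-- `A ⊆ B`. -/
def subset {n k : ℕ} (A B : Fin k) : Formula n k :=
  .all (.imp (.mem (.var 0) A) (.mem (.var 0) B))

/-- `I` is an initial segment of the order `X`. -/
def initialSegment {n k : ℕ} (X I : Fin k) : Formula n k :=
  (Formula.all (.imp (.mem (.var 0) I) (inField X (.var 0)))).and <|
  Formula.all (.all (.imp (.and (ordLt X (.var 1) (.var 0)) (.mem (.var 0) I)) (.mem (.var 1) I)))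

/-- `F` is an embedding of `I` into `J`, for subsets `I` and `J` of the linear order `X`: a function
such that `x <_X y` implies `F(x) <_X F(y)` for all `x, y` in `I`. -/
def embedding {n k : ℕ} (X I J F : Fin k) : Formula n k :=
  (function (fun t => .mem t I) (fun t => .mem t J) F).and <|
  -- the variables with indices `3, 2, 1, 0` stand for `x, y, F(x), F(y)`
  Formula.all (.all (.all (.all (.imp
    (.and (ordLt X (.var 3) (.var 2))
      (.and (.mem (pair (.var 3) (.var 1)) F) (.mem (pair (.var 2) (.var 0)) F)))
    (ordLt X (.var 1) (.var 0))))))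

/-- `X` is a weak well order: a linear order such that there is no embedding `F` of an initial
segment `I` of `X` into an initial segment `J` that is properly contained in `I`.  The set variables
with indices `2, 1, 0` below the quantifiers stand for `I, J, F`. -/
def weakWellOrder {n k : ℕ} (X : Fin k) : Formula n k :=
  (linearOrder X).and <| .not <| .exSet <| .exSet <| .exSet <|
    (initialSegment X.succ.succ.succ 2).and <|
    (initialSegment X.succ.succ.succ 1).and <|
    ((subset 1 2).and (.not (subset 2 1))).and <|
    embedding X.succ.succ.succ 2 1 0

/-- Every weak well order is a well order. -/
def weakWellOrdersAreWellOrders : Sentence :=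
  .allSet ((weakWellOrder 0).imp (wellOrder 0))

end SOA

namespace SOA

/-! ### Substitution and satisfaction -/

/-! Arithmetical comprehension reduces to the existence of projections `{x | ∃ w, pr w x ∈ S}`: one
quantifier at a time, sets of codes of tuples are complemented, intersected and projected
(`exists_tuple_mem_iff_sat`).

To project `S`, keep only the least witness of each `x`, obtaining an injective enumeration `E`
whose stages are the codes `pr w x`. A stage is true if no smaller number is enumerated later. If
`E` is unbounded, true stages enumerate arbitrarily large numbers, and a true stage enumerating `y`
has waited long enough for every `x < y`. Hence the set of true stages computes the projection
(`range_mem_of_unbounded`).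

To obtain the true stages, order all numbers by placing a stage below the later ones at which it
still appears true and above the other later ones. True stages then have boundedly many predecessors
and all other numbers boundedly many successors. Numbers that code no pair never appear true, so
they yield a descending sequence in the model. The order is therefore not a well order, and by
hypothesis not a weak well order.

The resulting embedding `f` of an initial segment `I` into a proper initial segment `J` reveals the
cut (`setOf_mem_of_not_weakWellOrder`). The set `D` of elements with `f(z) < z` has no least element
and contains some `x₀` in `I` outside `J`. Bounded nonempty sets do have least elements, so `D`
contains no true stage and leaves no gap among the false stages below `x₀`: the true stages are
exactly the elements below `x₀` outside `D`. -/

theorem Term.subst_subst {n m l : ℕ} (σ : Fin n → Term m) (τ : Fin m → Term l) (t : Term n) :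
    (t.subst σ).subst τ = t.subst fun i => (σ i).subst τ := by
  induction t <;> simp_all [Term.subst]

/-- Ensures that substitution turns a bounded quantifier into a bounded quantifier, with the
substituted term as bound. -/
theorem Term.lift_subst {n m : ℕ} (σ : Fin n → Term m) (t : Term n) :
    t.lift.subst (Fin.cons (.var 0 : Term (m + 1)) fun i => (σ i).lift) = (t.subst σ).lift := by
  simp [Term.lift, Term.subst_subst, Term.subst]

theorem Formula.IsSigma00.subst {n k : ℕ} {φ : Formula n k} (h : φ.IsSigma00) {m l : ℕ}
    (σ : Fin n → Term m) (ρ : Fin k → Fin l) : (φ.subst σ ρ).IsSigma00 := by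
  induction h generalizing m l with
  | eq s t => exact .eq _ _
  | lt s t => exact .lt _ _
  | mem t X => exact .mem _ _
  | not _ ih => exact .not (ih σ ρ)
  | and _ _ ih₁ ih₂ => exact .and (ih₁ σ ρ) (ih₂ σ ρ)
  | or _ _ ih₁ ih₂ => exact .or (ih₁ σ ρ) (ih₂ σ ρ)
  | imp _ _ ih₁ ih₂ => exact .imp (ih₁ σ ρ) (ih₂ σ ρ)
  | ball t _ ih =>
    have := IsSigma00.ball (t.subst σ) (ih (Fin.cons (.var 0) fun i => (σ i).lift) ρ)
    rw [Formula.ball, ← Term.lift_subst] at this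
    exact this
  | bex t _ ih =>
    have := IsSigma00.bex (t.subst σ) (ih (Fin.cons (.var 0) fun i => (σ i).lift) ρ)
    rw [Formula.bex, ← Term.lift_subst] at this
    exact this

namespace Model

instance (M : Model.{u}) : Zero M.carrier := ⟨M.zero⟩
instance (M : Model.{u}) : One M.carrier := ⟨M.one⟩
instance (M : Model.{u}) : Add M.carrier := ⟨M.add⟩
instance (M : Model.{u}) : Mul M.carrier := ⟨M.mul⟩
instance (M : Model.{u}) : LT M.carrier := ⟨M.lt⟩

variable {M : Model.{u}}

theorem val_subst {n m : ℕ} (v : Fin m → M.carrier) (σ : Fin n → Term m) (t : Term n) :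
    M.val v (t.subst σ) = M.val (fun i => M.val v (σ i)) t := by
  induction t <;> simp_all [Term.subst, val]

theorem val_lift {n : ℕ} (a : M.carrier) (v : Fin n → M.carrier) (t : Term n) :
    M.val (Fin.cons a v : Fin (n + 1) → M.carrier) t.lift = M.val v t := by
  simp [Term.lift, val_subst, val]

theorem val_cons_lift {n m : ℕ} (a : M.carrier) (v : Fin m → M.carrier) (σ : Fin n → Term m) :
    (fun i => M.val (Fin.cons a v : Fin (m + 1) → M.carrier)
      ((Fin.cons (.var 0) fun i => (σ i).lift : Fin (n + 1) → Term (m + 1)) i)) =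
    (Fin.cons a fun i => M.val v (σ i) : Fin (n + 1) → M.carrier) := by
  funext i
  refine Fin.cases ?_ (fun i => ?_) i
  · simp [val]
  · simp [val_lift]

theorem cons_comp_cons {k l : ℕ} (A : Set M.carrier) (V : Fin l → Set M.carrier)
    (ρ : Fin k → Fin l) :
    (fun i => (Fin.cons A V : Fin (l + 1) → Set M.carrier)
      ((Fin.cons 0 fun i => (ρ i).succ : Fin (k + 1) → Fin (l + 1)) i)) =
    (Fin.cons A fun i => V (ρ i) : Fin (k + 1) → Set M.carrier) := by
  funext i
  refine Fin.cases ?_ (fun i => ?_) i <;> simp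

theorem sat_subst {n m k l : ℕ} (φ : Formula n k) (v : Fin m → M.carrier)
    (V : Fin l → Set M.carrier) (σ : Fin n → Term m) (ρ : Fin k → Fin l) :
    M.Sat v V (φ.subst σ ρ) ↔ M.Sat (fun i => M.val v (σ i)) (fun i => V (ρ i)) φ := by
  induction φ generalizing m l with
  | eq | lt | mem => simp [Formula.subst, Sat, val_subst]
  | not _ ih => simp [Formula.subst, Sat, ih]
  | and _ _ ih₁ ih₂ | or _ _ ih₁ ih₂ | imp _ _ ih₁ ih₂ => simp [Formula.subst, Sat, ih₁, ih₂]
  | all _ ih | ex _ ih => simp only [Formula.subst, Sat, ih, val_cons_lift]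
  | allSet _ ih | exSet _ ih => simp only [Formula.subst, Sat, ih, cons_comp_cons]

theorem sat_closeNum {n k : ℕ} (φ : Formula n k) (V : Fin k → Set M.carrier) :
    M.Sat Fin.elim0 V φ.closeNum ↔ ∀ v, M.Sat v V φ := by
  induction n with
  | zero => exact ⟨fun h v => by rwa [Subsingleton.elim v Fin.elim0], fun h => h _⟩
  | succ n ih =>
    rw [Formula.closeNum, ih]
    refine ⟨fun h v => ?_, fun h v a => h _⟩
    rw [← Fin.cons_self_tail v]
    exact h _ _

theorem sat_closeSet {n k : ℕ} (φ : Formula n k) (v : Fin n → M.carrier) :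
    M.Sat v Fin.elim0 φ.closeSet ↔ ∀ V : Fin k → Set M.carrier, (∀ i, V i ∈ M.sets) →
      M.Sat v V φ := by
  induction k with
  | zero => exact ⟨fun h V _ => by rwa [Subsingleton.elim V Fin.elim0], fun h => h _ fun i => i.elim0⟩
  | succ k ih =>
    rw [Formula.closeSet, ih]
    refine ⟨fun h V hV => ?_, fun h V hV A hA => h _ fun i => ?_⟩
    · rw [← Fin.cons_self_tail V]
      exact h _ (fun i => hV i.succ) _ (hV 0)
    · refine Fin.cases hA hV i

theorem satisfies_close {n k : ℕ} (φ : Formula n k) :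
    M.Satisfies φ.close ↔ ∀ V : Fin k → Set M.carrier, (∀ i, V i ∈ M.sets) →
      ∀ v, M.Sat v V φ := by
  simp only [Satisfies, Formula.close, sat_closeSet, sat_closeNum]

/-! ### Definability -/

/-- Functions given by a term. -/
def TermDef {n : ℕ} (t : (Fin n → M.carrier) → M.carrier) : Prop :=
  ∃ τ : Term n, ∀ v, M.val v τ = t v

namespace TermDef

variable {n : ℕ} {s t : (Fin n → M.carrier) → M.carrier}

theorem var (i : Fin n) : TermDef (M := M) fun v => v i := ⟨.var i, fun _ => rfl⟩

theorem zero : TermDef (M := M) (n := n) fun _ => 0 := ⟨.zero, fun _ => rfl⟩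

theorem one : TermDef (M := M) (n := n) fun _ => 1 := ⟨.one, fun _ => rfl⟩

theorem add (hs : TermDef s) (ht : TermDef t) : TermDef fun v => s v + t v := by
  obtain ⟨σ, hσ⟩ := hs
  obtain ⟨τ, hτ⟩ := ht
  exact ⟨.add σ τ, fun v => by rw [val, hσ, hτ]; rfl⟩

theorem mul (hs : TermDef s) (ht : TermDef t) : TermDef fun v => s v * t v := by
  obtain ⟨σ, hσ⟩ := hs
  obtain ⟨τ, hτ⟩ := ht
  exact ⟨.mul σ τ, fun v => by rw [val, hσ, hτ]; rfl⟩

end TermDef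

/-- Predicates given by a `Σ⁰₀` formula with set parameters `V`. -/
def Sigma00Def {n k : ℕ} (V : Fin k → Set M.carrier) (P : (Fin n → M.carrier) → Prop) : Prop :=
  ∃ φ : Formula n k, φ.IsSigma00 ∧ ∀ v, M.Sat v V φ ↔ P v

namespace Sigma00Def

variable {n k : ℕ} {V : Fin k → Set M.carrier} {s t : (Fin n → M.carrier) → M.carrier}
  {P Q : (Fin n → M.carrier) → Prop}

theorem eq (hs : TermDef s) (ht : TermDef t) : Sigma00Def V fun v => s v = t v := by
  obtain ⟨σ, hσ⟩ := hs
  obtain ⟨τ, hτ⟩ := ht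
  exact ⟨.eq σ τ, .eq _ _, fun v => by simp only [Sat, hσ, hτ]⟩

theorem lt (hs : TermDef s) (ht : TermDef t) : Sigma00Def V fun v => s v < t v := by
  obtain ⟨σ, hσ⟩ := hs
  obtain ⟨τ, hτ⟩ := ht
  exact ⟨.lt σ τ, .lt _ _, fun v => by simp only [Sat, hσ, hτ]; rfl⟩

theorem mem (i : Fin k) (ht : TermDef t) : Sigma00Def V fun v => t v ∈ V i := by
  obtain ⟨τ, hτ⟩ := ht
  exact ⟨.mem τ i, .mem _ _, fun v => by simp only [Sat, hτ]⟩

theorem not (hP : Sigma00Def V P) : Sigma00Def V fun v => ¬ P v := by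
  obtain ⟨φ, hφ, h⟩ := hP
  exact ⟨φ.not, hφ.not, fun v => by simp only [Sat, h]⟩

theorem and (hP : Sigma00Def V P) (hQ : Sigma00Def V Q) : Sigma00Def V fun v => P v ∧ Q v := by
  obtain ⟨φ, hφ, h⟩ := hP
  obtain ⟨ψ, hψ, h'⟩ := hQ
  exact ⟨φ.and ψ, hφ.and hψ, fun v => by simp only [Sat, h, h']⟩

theorem or (hP : Sigma00Def V P) (hQ : Sigma00Def V Q) : Sigma00Def V fun v => P v ∨ Q v := by
  obtain ⟨φ, hφ, h⟩ := hP
  obtain ⟨ψ, hψ, h'⟩ := hQ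
  exact ⟨φ.or ψ, hφ.or hψ, fun v => by simp only [Sat, h, h']⟩

theorem imp (hP : Sigma00Def V P) (hQ : Sigma00Def V Q) : Sigma00Def V fun v => P v → Q v := by
  obtain ⟨φ, hφ, h⟩ := hP
  obtain ⟨ψ, hψ, h'⟩ := hQ
  exact ⟨φ.imp ψ, hφ.imp hψ, fun v => by simp only [Sat, h, h']⟩

theorem ball {R : M.carrier → (Fin n → M.carrier) → Prop} (ht : TermDef t)
    (hR : Sigma00Def V fun v : Fin (n + 1) → M.carrier => R (v 0) fun i => v i.succ) :
    Sigma00Def V fun v => ∀ a, a < t v → R a v := by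
  obtain ⟨τ, hτ⟩ := ht
  obtain ⟨φ, hφ, h⟩ := hR
  refine ⟨φ.ball τ, hφ.ball τ, fun v => ?_⟩
  simp only [Formula.ball, Sat, h, val_lift, hτ]
  rfl

theorem bex {R : M.carrier → (Fin n → M.carrier) → Prop} (ht : TermDef t)
    (hR : Sigma00Def V fun v : Fin (n + 1) → M.carrier => R (v 0) fun i => v i.succ) :
    Sigma00Def V fun v => ∃ a, a < t v ∧ R a v := by
  obtain ⟨τ, hτ⟩ := ht
  obtain ⟨φ, hφ, h⟩ := hR
  refine ⟨φ.bex τ, hφ.bex τ, fun v => ?_⟩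
  simp only [Formula.bex, Sat, h, val_lift, hτ]
  rfl

theorem comp_succ (hP : Sigma00Def V P) :
    Sigma00Def V fun v : Fin (n + 1) → M.carrier => P fun i => v i.succ := by
  obtain ⟨φ, hφ, h⟩ := hP
  refine ⟨φ.subst (fun i => .var i.succ) id, hφ.subst _ _, fun v => ?_⟩
  rw [sat_subst]
  exact h _

end Sigma00Def

/-- Structures in which the axioms of `RCA₀` are true. -/
class IsRCA0 (M : Model.{u}) : Prop where
  satisfies : ∀ ψ ∈ RCA0, M.Satisfies ψ

/-! ### Induction and comprehension for definable predicates. -/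

section Axioms

variable [hM : M.IsRCA0] {n k : ℕ} {V : Fin k → Set M.carrier}

/-- Applies the scheme to predicates instead of formulas. The arguments of `Q` are the unbounded
witness, the induction variable and the parameters. -/
theorem sigma01_induction (hV : ∀ i, V i ∈ M.sets)
    {Q : M.carrier → M.carrier → (Fin n → M.carrier) → Prop}
    (hQ : Sigma00Def V fun v : Fin (n + 2) → M.carrier => Q (v 0) (v 1) fun i => v i.succ.succ)
    (v : Fin n → M.carrier) (h0 : ∃ m, Q m 0 v)
    (hs : ∀ x, (∃ m, Q m x v) → ∃ m, Q m (x + 1) v) (x : M.carrier) : ∃ m, Q m x v := by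
  obtain ⟨φ, hφ, h⟩ := hQ
  have := (satisfies_close _).1 (hM.satisfies _ (.induction ⟨φ, hφ, rfl⟩)) V hV v
  simp only [inductionFor, Sat, sat_subst, id_eq, h] at this
  exact this ⟨h0, hs⟩ x

theorem sigma00_induction (hV : ∀ i, V i ∈ M.sets)
    {Q : M.carrier → (Fin n → M.carrier) → Prop}
    (hQ : Sigma00Def V fun v : Fin (n + 1) → M.carrier => Q (v 0) fun i => v i.succ)
    (v : Fin n → M.carrier) (h0 : Q 0 v) (hs : ∀ x, Q x v → Q (x + 1) v) (x : M.carrier) :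
    Q x v := by
  have := sigma01_induction (Q := fun _ x v => Q x v) hV hQ.comp_succ v ⟨0, h0⟩
    (fun x ⟨_, h⟩ => ⟨0, hs x h⟩) x
  exact this.elim fun _ h => h

theorem open_induction {Q : M.carrier → (Fin n → M.carrier) → Prop}
    (hQ : Sigma00Def (Fin.elim0 : Fin 0 → Set M.carrier)
      fun v : Fin (n + 1) → M.carrier => Q (v 0) fun i => v i.succ)
    (v : Fin n → M.carrier) (h0 : Q 0 v) (hs : ∀ x, Q x v → Q (x + 1) v) (x : M.carrier) :
    Q x v :=
  sigma00_induction (fun i => i.elim0) hQ v h0 hs x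

theorem delta01_comprehension (hV : ∀ i, V i ∈ M.sets)
    {Q R : M.carrier → M.carrier → (Fin n → M.carrier) → Prop}
    (hQ : Sigma00Def V fun v : Fin (n + 2) → M.carrier => Q (v 0) (v 1) fun i => v i.succ.succ)
    (hR : Sigma00Def V fun v : Fin (n + 2) → M.carrier => R (v 0) (v 1) fun i => v i.succ.succ)
    (v : Fin n → M.carrier) (hQR : ∀ x, (∃ m, Q m x v) ↔ ∀ m, R m x v) :
    {x | ∃ m, Q m x v} ∈ M.sets := by
  obtain ⟨φ, hφ, h⟩ := hQ
  obtain ⟨ψ, hψ, h'⟩ := hR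
  have := (satisfies_close _).1
    (hM.satisfies _ (.comprehension ⟨φ, hφ, rfl⟩ ⟨ψ, hψ, rfl⟩)) V hV v
  simp only [comprehensionFor, Formula.iff, Sat, sat_subst, Fin.cons_succ, h, h'] at this
  obtain ⟨A, hA, hA'⟩ := this fun x => ⟨(hQR x).1, (hQR x).2⟩
  convert hA
  ext x
  exact ⟨(hA' x).2, (hA' x).1⟩

theorem sigma00_comprehension (hV : ∀ i, V i ∈ M.sets)
    {Q : M.carrier → (Fin n → M.carrier) → Prop}
    (hQ : Sigma00Def V fun v : Fin (n + 1) → M.carrier => Q (v 0) fun i => v i.succ)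
    (v : Fin n → M.carrier) : {x | Q x v} ∈ M.sets := by
  have := delta01_comprehension (Q := fun _ x v => Q x v) (R := fun _ x v => Q x v) hV
    hQ.comp_succ hQ.comp_succ v fun x => ⟨fun ⟨_, h⟩ _ => h, fun h => ⟨0, h 0⟩⟩
  convert this using 2
  ext x
  exact ⟨fun h => ⟨0, h⟩, fun ⟨_, h⟩ => h⟩

end Axioms

/-! ### Arithmetic in models of `RCA₀` -/

section Arithmetic

variable [hM : M.IsRCA0]

protected theorem succ_ne_zero (a : M.carrier) : a + 1 ≠ 0 :=
  hM.satisfies _ (.basic .succ_ne_zero) a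

protected theorem succ_inj {a b : M.carrier} (h : a + 1 = b + 1) : a = b :=
  hM.satisfies _ (.basic .succ_inj) a b h

protected theorem add_zero (a : M.carrier) : a + 0 = a :=
  hM.satisfies _ (.basic .add_zero) a

protected theorem add_succ (a b : M.carrier) : a + (b + 1) = a + b + 1 :=
  hM.satisfies _ (.basic .add_succ) a b

protected theorem mul_zero (a : M.carrier) : a * 0 = 0 :=
  hM.satisfies _ (.basic .mul_zero) a

protected theorem mul_succ (a b : M.carrier) : a * (b + 1) = a * b + a :=
  hM.satisfies _ (.basic .mul_succ) a b

protected theorem not_lt_zero (a : M.carrier) : ¬ a < 0 :=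
  hM.satisfies _ (.basic .not_lt_zero) a

protected theorem lt_succ {a b : M.carrier} : a < b + 1 ↔ a < b ∨ a = b :=
  ⟨(hM.satisfies _ (.basic .lt_succ) a b).1, (hM.satisfies _ (.basic .lt_succ) a b).2⟩

protected theorem zero_add (a : M.carrier) : 0 + a = a :=
  open_induction (Q := fun x _ => 0 + x = x) (.eq (.add .zero (.var _)) (.var _))
    ![] (Model.add_zero 0) (fun x h => by rw [Model.add_succ, h]) a

protected theorem succ_add (a b : M.carrier) : a + 1 + b = a + b + 1 :=
  open_induction (Q := fun x v => v 0 + 1 + x = v 0 + x + 1)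
    (.eq (.add (.add (.var 1) .one) (.var 0)) (.add (.add (.var 1) (.var 0)) .one))
    ![a] (by simp only [Model.add_zero])
    (fun x h => by rw [Model.add_succ, h, Model.add_succ]) b

protected theorem add_comm (a b : M.carrier) : a + b = b + a :=
  open_induction (Q := fun x v => v 0 + x = x + v 0)
    (.eq (.add (.var 1) (.var 0)) (.add (.var 0) (.var 1)))
    ![a] (by rw [Model.add_zero, Model.zero_add])
    (fun x h => by rw [Model.add_succ, h, Model.succ_add]) b

protected theorem add_assoc (a b c : M.carrier) : a + b + c = a + (b + c) :=
  open_induction (Q := fun x v => v 0 + v 1 + x = v 0 + (v 1 + x))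
    (.eq (.add (.add (.var 1) (.var 2)) (.var 0)) (.add (.var 1) (.add (.var 2) (.var 0))))
    ![a, b] (by simp only [Model.add_zero])
    (fun x h => by simp only [Model.add_succ, h]) c

protected theorem zero_mul (a : M.carrier) : 0 * a = 0 :=
  open_induction (Q := fun x _ => 0 * x = 0) (.eq (.mul .zero (.var _)) .zero)
    ![] (Model.mul_zero 0) (fun x h => by rw [Model.mul_succ, h, Model.add_zero]) a

protected theorem succ_mul (a b : M.carrier) : (a + 1) * b = a * b + b :=
  open_induction (Q := fun x v => (v 0 + 1) * x = v 0 * x + x)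
    (.eq (.mul (.add (.var 1) .one) (.var 0)) (.add (.mul (.var 1) (.var 0)) (.var 0)))
    ![a] (by simp only [Model.mul_zero, Model.add_zero])
    (fun x h => by
      rw [Model.mul_succ, h, Model.mul_succ, Model.add_succ, Model.add_succ]
      exact congrArg (· + 1) (by rw [Model.add_assoc, Model.add_comm x, ← Model.add_assoc])) b

protected theorem mul_comm (a b : M.carrier) : a * b = b * a :=
  open_induction (Q := fun x v => v 0 * x = x * v 0)
    (.eq (.mul (.var 1) (.var 0)) (.mul (.var 0) (.var 1)))
    ![a] (by rw [Model.mul_zero, Model.zero_mul])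
    (fun x h => by rw [Model.mul_succ, h, Model.succ_mul]) b

protected theorem mul_add (a b c : M.carrier) : a * (b + c) = a * b + a * c :=
  open_induction (Q := fun x v => v 0 * (v 1 + x) = v 0 * v 1 + v 0 * x)
    (.eq (.mul (.var 1) (.add (.var 2) (.var 0)))
      (.add (.mul (.var 1) (.var 2)) (.mul (.var 1) (.var 0))))
    ![a, b] (by simp only [Model.add_zero, Model.mul_zero])
    (fun x h => by
      rw [Model.add_succ, Model.mul_succ, h, Model.mul_succ, Model.add_assoc]) c

protected theorem mul_assoc (a b c : M.carrier) : a * b * c = a * (b * c) :=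
  open_induction (Q := fun x v => v 0 * v 1 * x = v 0 * (v 1 * x))
    (.eq (.mul (.mul (.var 1) (.var 2)) (.var 0)) (.mul (.var 1) (.mul (.var 2) (.var 0))))
    ![a, b] (by simp only [Model.mul_zero])
    (fun x h => by rw [Model.mul_succ, h, Model.mul_succ, Model.mul_add]) c

protected theorem mul_one (a : M.carrier) : a * 1 = a := by
  rw [← Model.zero_add 1, Model.mul_succ, Model.mul_zero, Model.zero_add]

instance : CommSemiring M.carrier where
  add_assoc := Model.add_assoc
  zero_add := Model.zero_add
  add_zero := Model.add_zero
  add_comm := Model.add_comm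
  nsmul := nsmulRec
  left_distrib := Model.mul_add
  right_distrib a b c := by rw [Model.mul_comm, Model.mul_add, Model.mul_comm c, Model.mul_comm c]
  zero_mul := Model.zero_mul
  mul_zero := Model.mul_zero
  mul_assoc := Model.mul_assoc
  one_mul a := by rw [Model.mul_comm, Model.mul_one]
  mul_one := Model.mul_one
  mul_comm := Model.mul_comm

/-! ### The ordering of the first-order part. -/

protected theorem lt_trans {a b c : M.carrier} (hab : a < b) (hbc : b < c) : a < c :=
  open_induction (Q := fun x v => v 1 < x → v 0 < x)
    (.imp (.lt (.var 2) (.var 0)) (.lt (.var 1) (.var 0)))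
    ![a, b] (fun h => (Model.not_lt_zero _ h).elim)
    (fun _ ih h => Model.lt_succ.2 <| .inl <| (Model.lt_succ.1 h).elim ih fun h => h ▸ hab) c hbc

protected theorem lt_irrefl (a : M.carrier) : ¬ a < a :=
  open_induction (Q := fun x _ => ¬ x < x) (.not (.lt (.var 0) (.var 0)))
    ![] (Model.not_lt_zero 0)
    (fun x ih h => by
      have hx : x < x + 1 := Model.lt_succ.2 (.inr rfl)
      rcases Model.lt_succ.1 h with h | h
      · exact ih (Model.lt_trans hx h)
      · rw [h] at hx
        exact ih hx) a

protected theorem succ_lt_succ {a b : M.carrier} (h : a < b) : a + 1 < b + 1 :=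
  open_induction (Q := fun x v => v 0 < x → v 0 + 1 < x + 1)
    (.imp (.lt (.var 1) (.var 0)) (.lt (.add (.var 1) .one) (.add (.var 0) .one)))
    ![a] (fun h => (Model.not_lt_zero _ h).elim)
    (fun _ ih h => Model.lt_succ.2 <|
      (Model.lt_succ.1 h).imp ih (congrArg (· + 1))) b h

protected theorem zero_lt_succ (a : M.carrier) : 0 < a + 1 :=
  open_induction (Q := fun x _ => 0 < x + 1) (.lt .zero (.add (.var 0) .one))
    ![] (Model.lt_succ.2 (.inr rfl)) (fun _ h => Model.lt_succ.2 (.inl h)) a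

protected theorem lt_trichotomy (a b : M.carrier) : a < b ∨ a = b ∨ b < a :=
  open_induction (Q := fun x v => v 0 < x ∨ v 0 = x ∨ x < v 0)
    (.or (.lt (.var 1) (.var 0)) (.or (.eq (.var 1) (.var 0)) (.lt (.var 0) (.var 1))))
    ![a] (open_induction (Q := fun x _ => x < 0 ∨ x = 0 ∨ 0 < x)
      (.or (.lt (.var 0) .zero) (.or (.eq (.var 0) .zero) (.lt .zero (.var 0))))
      ![] (.inr (.inl rfl)) (fun _ _ => .inr (.inr (Model.zero_lt_succ _))) a)
    (fun x h => by
      rcases h with h | h | h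
      · exact .inl (Model.lt_succ.2 (.inl h))
      · exact .inl (Model.lt_succ.2 (.inr h))
      · have key : x < a → x + 1 = a ∨ x + 1 < a :=
          open_induction (Q := fun y v => v 0 < y → v 0 + 1 = y ∨ v 0 + 1 < y)
            (.imp (.lt (.var 1) (.var 0)) (.or (.eq (.add (.var 1) .one) (.var 0))
              (.lt (.add (.var 1) .one) (.var 0))))
            ![x] (fun h => (Model.not_lt_zero _ h).elim)
            (fun y _ h => (Model.lt_succ.1 h).elim (fun h => .inr (Model.succ_lt_succ h))
              fun h => .inl (congrArg (· + 1) h)) a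
        exact .inr ((key h).imp Eq.symm id)) b

open Classical in
noncomputable instance : LinearOrder M.carrier where
  le a b := a < b ∨ a = b
  le_refl _ := .inr rfl
  le_trans := by
    rintro a b c (h | rfl) (h' | rfl)
    · exact .inl (Model.lt_trans h h')
    · exact .inl h
    · exact .inl h'
    · exact .inr rfl
  le_antisymm := by
    rintro a b (h | rfl) (h' | h')
    · exact (Model.lt_irrefl a (Model.lt_trans h h')).elim
    · exact h'.symm
    · rfl
    · rfl
  lt_iff_le_not_ge a b := by
    refine ⟨fun h => ⟨.inl h, ?_⟩, ?_⟩
    · rintro (h' | rfl)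
      · exact Model.lt_irrefl a (Model.lt_trans h h')
      · exact Model.lt_irrefl _ h
    · rintro ⟨h | rfl, h'⟩
      · exact h
      · exact (h' (.inr rfl)).elim
  le_total a b := by
    rcases Model.lt_trichotomy a b with h | h | h
    · exact .inl (.inl h)
    · exact .inl (.inr h)
    · exact .inr (.inl h)
  toDecidableLE := Classical.decRel _

protected theorem zero_le (a : M.carrier) : 0 ≤ a := not_lt.1 (Model.not_lt_zero a)

theorem lt_add_one_iff {a b : M.carrier} : a < b + 1 ↔ a ≤ b := Model.lt_succ

theorem add_one_le_iff {a b : M.carrier} : a + 1 ≤ b ↔ a < b := by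
  rw [← not_lt, lt_add_one_iff, not_le]

theorem lt_add_one_self (a : M.carrier) : a < a + 1 := lt_add_one_iff.2 le_rfl

protected theorem add_lt_add_left {a b : M.carrier} (h : a < b) (c : M.carrier) : a + c < b + c :=
  open_induction (Q := fun x v => v 0 + x < v 1 + x)
    (.lt (.add (.var 1) (.var 0)) (.add (.var 2) (.var 0)))
    ![a, b] (by simpa using h)
    (fun x ih => by rw [← add_assoc, ← add_assoc]; exact Model.succ_lt_succ ih) c

protected theorem add_le_add_left {a b : M.carrier} (h : a ≤ b) (c : M.carrier) : c + a ≤ c + b := by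
  rw [add_comm c, add_comm c]
  rcases h with h | rfl
  · exact .inl (Model.add_lt_add_left h c)
  · exact le_rfl

protected theorem mul_le_mul_left {a b : M.carrier} (h : a ≤ b) (c : M.carrier) : c * a ≤ c * b :=
  open_induction (Q := fun x v => ¬ x * v 1 < x * v 0)
    (.not (.lt (.mul (.var 0) (.var 2)) (.mul (.var 0) (.var 1))))
    ![a, b] (by simp)
    (fun x ih => by
      rw [not_lt] at ih ⊢
      rw [add_mul, add_mul, one_mul, one_mul]
      refine (Model.add_le_add_left h _).trans ?_
      rw [add_comm, add_comm (x * _)]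
      exact Model.add_le_add_left ih _) c |> not_lt.1

instance : IsOrderedCancelAddMonoid M.carrier where
  add_le_add_left a b h c := by rw [add_comm a, add_comm b]; exact Model.add_le_add_left h c
  le_of_add_le_add_left a b c h := by
    rw [← not_lt] at h ⊢
    intro hcb
    rw [add_comm a, add_comm a] at h
    exact h (Model.add_lt_add_left hcb a)

/-! ### Pairing. -/

theorem mul_self_le_mul_self_of_le {a b : M.carrier} (h : a ≤ b) : a * a ≤ b * b :=
  (Model.mul_le_mul_left h a).trans (by rw [mul_comm a]; exact Model.mul_le_mul_left h b)

theorem le_add_left_self (a b : M.carrier) : a ≤ a + b := by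
  simpa using Model.add_le_add_left (Model.zero_le b) a

theorem le_mul_self (a : M.carrier) : a ≤ a * a := by
  rcases eq_or_lt_of_le (Model.zero_le a) with rfl | h
  · simp
  · have := Model.mul_le_mul_left (add_one_le_iff.2 h) a
    simpa using this

/-- The code of a pair. -/
def pr (a b : M.carrier) : M.carrier := (a + b) * (a + b) + a

/-- Codes of pairs with sum `p` lie between `p²` and `p² + p`, hence below `(p + 1)²`. These
intervals are disjoint for different sums, which makes pairing injective. -/
theorem lt_succ_mul_self (p : M.carrier) {q a : M.carrier} (hpq : p < q) (ha : a ≤ p) :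
    p * p + a + 1 ≤ q * q := by
  refine le_trans ?_ (mul_self_le_mul_self_of_le (add_one_le_iff.2 hpq))
  have h : p * p + a + 1 ≤ p * p + p + 1 := by gcongr
  refine h.trans ?_
  have := le_add_left_self (p * p + p + 1) p
  convert this using 1
  ring

theorem pr_inj {a b c d : M.carrier} (h : pr a b = pr c d) : a = c ∧ b = d := by
  unfold pr at h
  rcases lt_trichotomy (a + b) (c + d) with hp | hp | hp
  · have h' := lt_succ_mul_self _ hp (le_add_left_self a b)
    rw [h, add_one_le_iff] at h'
    exact (not_le.2 h' (le_add_left_self _ _)).elim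
  · rw [hp] at h
    obtain rfl := add_left_cancel h
    exact ⟨rfl, add_left_cancel hp⟩
  · have h' := lt_succ_mul_self _ hp (le_add_left_self c d)
    rw [← h, add_one_le_iff] at h'
    exact (not_le.2 h' (le_add_left_self _ _)).elim

theorem left_le_pr (a b : M.carrier) : a ≤ pr a b := by
  rw [pr, add_comm]
  exact le_add_left_self _ _

theorem right_le_pr (a b : M.carrier) : b ≤ pr a b := by
  refine le_trans ?_ ((le_mul_self (a + b)).trans (le_add_left_self _ _))
  rw [add_comm]
  exact le_add_left_self _ _

/-- With `q = n + 1`, the number `q² + q + 1` falls into the gap between the codes of sum at most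
`q` and those of sum at least `q + 1`. The gap before `(q + 1)²` is nonempty only for `q ≥ 1`. -/
theorem ne_pr (n a b : M.carrier) : pr a b ≠ (n + 1) * (n + 1) + (n + 1) + 1 := by
  intro h
  rcases le_or_gt (a + b) (n + 1) with hp | hp
  · have := (add_le_add (mul_self_le_mul_self_of_le hp) ((le_add_left_self a b).trans hp))
    rw [← pr, h, add_one_le_iff] at this
    exact this.false
  · have h1 := mul_self_le_mul_self_of_le (add_one_le_iff.2 hp)
    have h2 := h1.trans (le_add_left_self _ a)
    rw [← pr, h] at h2
    have h3 : (n + 1) * (n + 1) + (n + 1) + 1 < (n + 1 + 1) * (n + 1 + 1) := by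
      rw [← add_one_le_iff]
      have := le_add_left_self ((n + 1) * (n + 1) + (n + 1) + 1 + 1) n
      convert this using 1
      ring
    exact absurd h2 (not_le.2 h3)

end Arithmetic

theorem TermDef.pr {n : ℕ} {s t : (Fin n → M.carrier) → M.carrier} (hs : TermDef s)
    (ht : TermDef t) : TermDef fun v => Model.pr (s v) (t v) :=
  .add (.mul (.add hs ht) (.add hs ht)) hs

namespace Sigma00Def

variable [hM : M.IsRCA0] {n k : ℕ} {V : Fin k → Set M.carrier}
  {s t : (Fin n → M.carrier) → M.carrier}

theorem le (hs : TermDef s) (ht : TermDef t) : Sigma00Def V fun v => s v ≤ t v :=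
  .or (.lt hs ht) (.eq hs ht)

theorem ball_le {R : M.carrier → (Fin n → M.carrier) → Prop} (ht : TermDef t)
    (hR : Sigma00Def V fun v : Fin (n + 1) → M.carrier => R (v 0) fun i => v i.succ) :
    Sigma00Def V fun v => ∀ a, a ≤ t v → R a v := by
  simpa only [lt_add_one_iff] using Sigma00Def.ball (ht.add .one) hR

theorem bex_le {R : M.carrier → (Fin n → M.carrier) → Prop} (ht : TermDef t)
    (hR : Sigma00Def V fun v : Fin (n + 1) → M.carrier => R (v 0) fun i => v i.succ) :
    Sigma00Def V fun v => ∃ a, a ≤ t v ∧ R a v := by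
  simpa only [lt_add_one_iff] using Sigma00Def.bex (ht.add .one) hR

end Sigma00Def

/-! ### Least elements from `Σ⁰₁` induction. -/

section Minimum

variable [hM : M.IsRCA0]

theorem exists_min_snd {C : Set M.carrier} (hC : C ∈ M.sets) {x : M.carrier}
    (hx : ∃ m, pr m x ∈ C) : ∃ x, (∃ m, pr m x ∈ C) ∧ ∀ y m, pr m y ∈ C → x ≤ y := by
  by_contra hcon
  push Not at hcon
  obtain ⟨m, hm⟩ := hx
  -- Without a minimum one can descend `b` times from `x` for every `b`, which fails for `b = x +
  -- 1`. The single witness `z` bounds both `y` and `m`.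
  have key := sigma01_induction (M := M) (V := ![C]) (by simpa using hC)
    (Q := fun z b v => ∃ y, y ≤ z ∧ ∃ m, m ≤ z ∧ (y + b ≤ v 0 ∧ pr m y ∈ C))
    (.bex_le (.var 0) (.bex_le (.var 1)
      (.and (.le (.add (.var 1) (.var 3)) (.var 4)) (.mem 0 (.pr (.var 0) (.var 1))))))
    ![x] ⟨max x m, x, le_max_left _ _, m, le_max_right _ _, by simp, hm⟩
    (by
      rintro b ⟨z, y, -, m, -, h, hm⟩
      obtain ⟨y', m', hm', hy'⟩ := hcon y ⟨m, hm⟩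
      refine ⟨max y' m', y', le_max_left _ _, m', le_max_right _ _, le_trans ?_ h, hm'⟩
      rw [← add_assoc, add_right_comm]
      gcongr
      exact add_one_le_iff.2 hy') (x + 1)
  obtain ⟨z, y, -, m, -, h, -⟩ := key
  refine absurd h (not_le.2 ((lt_add_one_self x).trans_le ?_))
  rw [add_comm y]
  exact le_add_left_self (x + 1) y

/-- A nonempty bounded set has a least element with respect to a linear order. -/
theorem exists_min_of_bounded {B X : Set M.carrier} (hB : B ∈ M.sets) (hX : X ∈ M.sets)
    (hrefl : ∀ a, pr a a ∈ X) (htrans : ∀ a b c, pr a b ∈ X → pr b c ∈ X → pr a c ∈ X)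
    (htotal : ∀ a b, pr a b ∈ X ∨ pr b a ∈ X) (hne : B.Nonempty) {k : M.carrier}
    (hk : ∀ a ∈ B, a ≤ k) : ∃ a ∈ B, ∀ b ∈ B, pr a b ∈ X := by
  obtain ⟨a, ha⟩ := hne
  -- Induction on `n`: some element of `B` is least among the elements of `B` below `n`.
  have key := sigma01_induction (M := M) (V := ![B, X]) (by simp [Fin.forall_fin_two, hB, hX])
    (Q := fun a n _ => a ∈ B ∧ ∀ m, m < n → m ∈ B → pr a m ∈ X)
    (.and (.mem 0 (.var 0)) (.ball (.var 1) (.imp (.mem 0 (.var 0)) (.mem 1 (.pr (.var 1) (.var 0))))))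
    ![] ⟨a, ha, fun m hm => (Model.not_lt_zero m hm).elim⟩
    (by
      rintro n ⟨a, ha, h⟩
      by_cases hn : n ∈ B
      · rcases htotal a n with han | hna
        · exact ⟨a, ha, fun m hm hmB => (Model.lt_succ.1 hm).elim (fun h' => h m h' hmB)
            fun h' => h' ▸ han⟩
        · exact ⟨n, hn, fun m hm hmB => (Model.lt_succ.1 hm).elim
            (fun h' => htrans _ _ _ hna (h m h' hmB)) fun h' => h' ▸ hrefl _⟩
      · exact ⟨a, ha, fun m hm hmB => (Model.lt_succ.1 hm).elim (fun h' => h m h' hmB)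
          fun h' => (hn (h' ▸ hmB)).elim⟩) (k + 1)
  obtain ⟨a, ha, h⟩ := key
  exact ⟨a, ha, fun b hb => h b (lt_add_one_iff.2 (hk b hb)) hb⟩

end Minimum

/-! ### Orders in models -/

/-- The set `X` codes a linear order. -/
def IsLinear (X : Set M.carrier) : Prop :=
  (∀ a b, pr a b ∈ X → pr a a ∈ X ∧ pr b b ∈ X) ∧
  (∀ a b, pr a b ∈ X ∧ pr b a ∈ X → a = b) ∧
  (∀ a b c, pr a b ∈ X ∧ pr b c ∈ X → pr a c ∈ X) ∧
  ∀ a b, pr a a ∈ X ∧ pr b b ∈ X → pr a b ∈ X ∨ pr b a ∈ X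

/-- The set `F` codes a function from `A` to `B`. -/
def IsFunction (A B : M.carrier → Prop) (F : Set M.carrier) : Prop :=
  (∀ p, p ∈ F → ∃ a b, p = pr a b ∧ A a ∧ B b) ∧
  (∀ a, A a → ∃ b, pr a b ∈ F) ∧
  ∀ a b c, pr a b ∈ F ∧ pr a c ∈ F → b = c

/-- The set `I` is an initial segment of `X`. -/
def IsInitial (X I : Set M.carrier) : Prop :=
  (∀ a, a ∈ I → pr a a ∈ X) ∧ ∀ a b, (pr a b ∈ X ∧ ¬ a = b) ∧ b ∈ I → a ∈ I

/-- Evaluating the formula under the assignment is pure computation, so this is definitional. -/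
theorem sat_weakWellOrder {X : Set M.carrier} :
    M.Sat Fin.elim0 (Fin.cons X Fin.elim0 : Fin 1 → Set M.carrier) (weakWellOrder 0) ↔
      IsLinear X ∧ ¬ ∃ I ∈ M.sets, ∃ J ∈ M.sets, ∃ F ∈ M.sets, IsInitial X I ∧ IsInitial X J ∧
        ((∀ a, a ∈ J → a ∈ I) ∧ ¬ ∀ a, a ∈ I → a ∈ J) ∧ IsFunction (· ∈ I) (· ∈ J) F ∧
        ∀ a b c d, (pr a b ∈ X ∧ ¬ a = b) ∧ pr a c ∈ F ∧ pr b d ∈ F → pr c d ∈ X ∧ ¬ c = d :=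
  Iff.rfl

theorem sat_wellOrder {X : Set M.carrier} :
    M.Sat Fin.elim0 (Fin.cons X Fin.elim0 : Fin 1 → Set M.carrier) (wellOrder 0) ↔
      IsLinear X ∧ ¬ ∃ F ∈ M.sets, IsFunction (fun a => a = a) (fun a => pr a a ∈ X) F ∧
        ∀ a b c, pr a b ∈ F ∧ pr (a + 1) c ∈ F → pr c b ∈ X ∧ ¬ c = b :=
  Iff.rfl

/-! ### The cut revealed by a self-embedding. -/

section CutOfSelfEmbedding

variable [hM : M.IsRCA0]

theorem isFunction_mem {A B : M.carrier → Prop} {F : Set M.carrier} (hF : IsFunction A B F)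
    {a b : M.carrier} (h : pr a b ∈ F) : A a ∧ B b := by
  obtain ⟨a', b', hp, ha, hb⟩ := hF.1 _ h
  obtain ⟨rfl, rfl⟩ := pr_inj hp
  exact ⟨ha, hb⟩

/-- Suppose that the elements satisfying `P` have boundedly many predecessors, and the others have
boundedly many successors.  If `X` is not a weak well order, then `P` defines a set. -/
theorem setOf_mem_of_not_weakWellOrder {X : Set M.carrier} (hX : X ∈ M.sets) (hlin : IsLinear X)
    (hrefl : ∀ a, pr a a ∈ X) {P : M.carrier → Prop}
    (htrue : ∀ z, P z → ∃ k, ∀ u, pr u z ∈ X → u ≤ k)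
    (hfalse : ∀ z, ¬ P z → ∃ k, ∀ u, pr z u ∈ X → u ≤ k)
    (hW : ¬ M.Sat Fin.elim0 (Fin.cons X Fin.elim0 : Fin 1 → Set M.carrier) (weakWellOrder 0)) :
    {z | P z} ∈ M.sets := by
  rw [sat_weakWellOrder] at hW
  push Not at hW
  obtain ⟨I, hI, J, hJ, F, hF, hinI, hinJ, ⟨hJI, hIJ⟩, hfun, hemb⟩ := hW hlin
  obtain ⟨x₀, hx₀I, hx₀J⟩ := hIJ
  obtain ⟨-, hanti, htrans, htotal⟩ := hlin
  replace htrans : ∀ a b c, pr a b ∈ X → pr b c ∈ X → pr a c ∈ X :=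
    fun a b c h h' => htrans a b c ⟨h, h'⟩
  replace htotal : ∀ a b, pr a b ∈ X ∨ pr b a ∈ X := fun a b => htotal a b ⟨hrefl a, hrefl b⟩
  -- The elements that the embedding moves strictly down.
  set D : Set M.carrier := {z | ∃ y, pr z y ∈ F ∧ pr z y ∉ X} with hDdef
  have hD : D ∈ M.sets := by
    -- Since `F` is total on `I` and single-valued, "some value" may be replaced by "every value".
    refine delta01_comprehension (V := ![X, F, I]) (by simp [Fin.forall_fin_succ, hX, hF, hI])
      (Q := fun y z _ => pr z y ∈ F ∧ pr z y ∉ X)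
      (R := fun y z _ => z ∈ I ∧ (pr z y ∈ F → pr z y ∉ X))
      (.and (.mem 1 (.pr (.var 1) (.var 0))) (.not (.mem 0 (.pr (.var 1) (.var 0)))))
      (.and (.mem 2 (.var 1)) (.imp (.mem 1 (.pr (.var 1) (.var 0)))
        (.not (.mem 0 (.pr (.var 1) (.var 0)))))) ![] fun z => ⟨?_, fun h => ?_⟩
    · rintro ⟨y, hy, hy'⟩ m
      refine ⟨(isFunction_mem hfun hy).1, fun hm => ?_⟩
      rwa [hfun.2.2 _ _ _ ⟨hm, hy⟩]
    · obtain ⟨y, hy⟩ := hfun.2.1 z (h 0).1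
      exact ⟨y, hy, (h y).2 hy⟩
  -- Applying the embedding to `f(u) < u` gives `f(f(u)) < f(u)`, so `f` maps `D` into itself.
  have hdesc : ∀ u ∈ D, ∃ y ∈ D, pr u y ∈ F ∧ pr u y ∉ X := by
    rintro u ⟨y, hy, hyX⟩
    have hyu : pr y u ∈ X := (htotal u y).resolve_left hyX
    have hne : ¬ y = u := fun h => hyX (h ▸ hrefl y)
    obtain ⟨y', hy'⟩ := hfun.2.1 y (hJI _ (isFunction_mem hfun hy).2)
    obtain ⟨h1, h2⟩ := hemb y u y' y ⟨⟨hyu, hne⟩, hy', hy⟩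
    exact ⟨y, ⟨y', hy', fun h => h2 (hanti _ _ ⟨h1, h⟩)⟩, hy, hyX⟩
  -- Otherwise `x₀ ≤ f(x₀) ∈ J`, which would put `x₀` into the initial segment `J`.
  have hx₀D : x₀ ∈ D := by
    obtain ⟨y, hy⟩ := hfun.2.1 x₀ hx₀I
    have hyJ := (isFunction_mem hfun hy).2
    refine ⟨y, hy, fun h => hx₀J ?_⟩
    by_cases hxy : x₀ = y
    · rwa [hxy]
    · exact hinJ.2 _ _ ⟨⟨h, hxy⟩, hyJ⟩
  -- Below an element satisfying `P`, the set `D` is bounded; a least element `u` there is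
  -- contradicted by `f(u)`.
  have hDfalse : ∀ z ∈ D, ¬ P z := by
    intro z hz hPz
    obtain ⟨k, hk⟩ := htrue z hPz
    obtain ⟨u, ⟨huD, huz⟩, hmin⟩ := exists_min_of_bounded (B := {u | u ∈ D ∧ pr u z ∈ X})
      (sigma00_comprehension (V := ![X, D]) (by simp [Fin.forall_fin_succ, hX, hD])
        (Q := fun u v => u ∈ D ∧ pr u (v 0) ∈ X)
        (.and (.mem 1 (.var 0)) (.mem 0 (.pr (.var 0) (.var 1)))) ![z])
      hX hrefl htrans htotal ⟨z, hz, hrefl z⟩ (fun a ha => hk a ha.2)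
    obtain ⟨y, hyD, -, hyX⟩ := hdesc u huD
    exact hyX (hmin y ⟨hyD, htrans _ _ _ ((htotal u y).resolve_left hyX) huz⟩)
  -- If `P z` fails, the part of `D` above `z` is bounded and has a least element `u`. But `z ≤ f(z)
  -- < f(u) < u` with `f(u) ∈ D`.
  have hDtrue : ∀ z, pr z x₀ ∈ X → z ∉ D → P z := by
    intro z hzx hzD
    by_contra hPz
    obtain ⟨k, hk⟩ := hfalse z hPz
    obtain ⟨u, ⟨huD, hzu⟩, hmin⟩ := exists_min_of_bounded (B := {u | u ∈ D ∧ pr z u ∈ X})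
      (sigma00_comprehension (V := ![X, D]) (by simp [Fin.forall_fin_succ, hX, hD])
        (Q := fun u v => u ∈ D ∧ pr (v 0) u ∈ X)
        (.and (.mem 1 (.var 0)) (.mem 0 (.pr (.var 1) (.var 0)))) ![z])
      hX hrefl htrans htotal ⟨x₀, hx₀D, hzx⟩ (fun a ha => hk a ha.2)
    obtain ⟨y, hyD, huy, hyX⟩ := hdesc u huD
    have hzI : z ∈ I := by
      by_cases h : z = x₀
      · rwa [h]
      · exact hinI.2 _ _ ⟨⟨hzx, h⟩, hx₀I⟩
    obtain ⟨z', hz'⟩ := hfun.2.1 z hzI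
    have hzz' : pr z z' ∈ X := by
      by_contra h
      exact hzD ⟨z', hz', h⟩
    have hz'y := (hemb z u z' y ⟨⟨hzu, fun h => hzD (h ▸ huD)⟩, hz', huy⟩).1
    exact hyX (hmin y ⟨hyD, htrans _ _ _ hzz' hz'y⟩)
  have hle : ∀ z, P z → pr z x₀ ∈ X := by
    intro z hz
    by_contra h
    obtain ⟨k, hk⟩ := htrue z hz
    obtain ⟨l, hl⟩ := hfalse x₀ (hDfalse x₀ hx₀D)
    -- The number `max k l + 1` is too large to precede `z`, and too large to succeed `x₀`.
    have h1 : pr z (max k l + 1) ∈ X := (htotal _ _).resolve_right fun h' =>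
      absurd ((lt_add_one_self _).trans_le (hk _ h')) (not_lt.2 (le_max_left _ _))
    have h2 := hl _ (htrans _ _ _ ((htotal z x₀).resolve_left h) h1)
    exact absurd ((lt_add_one_self _).trans_le h2) (not_lt.2 (le_max_right _ _))
  have hfinal := sigma00_comprehension (V := ![X, D]) (by simp [Fin.forall_fin_succ, hX, hD])
    (Q := fun z v => pr z (v 0) ∈ X ∧ z ∉ D)
    (.and (.mem 0 (.pr (.var 0) (.var 1))) (.not (.mem 1 (.var 0)))) ![x₀]
  convert hfinal using 2
  ext z
  exact ⟨fun h => ⟨hle z h, fun hz => hDfalse z hz h⟩, fun h => hDtrue z h.1 h.2⟩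

end CutOfSelfEmbedding

/-! ### The order of true stages -/

section TrueStages

/-- A number `pr w x` in `E` is seen as the stage at which `x` is enumerated.  It turns out to be
false at a later stage `k` if a smaller number is enumerated at `k`. -/
def Refutes (E : Set M.carrier) (k a : M.carrier) : Prop :=
  a < k ∧ k ∈ E ∧ ∃ w x w' x', a = pr w x ∧ k = pr w' x' ∧ x' < x

variable [hM : M.IsRCA0] {E : Set M.carrier}

/-- The stage `a` enumerates a number, and appears to be true at stage `b`. -/
def AppearsTrue (E : Set M.carrier) (a b : M.carrier) : Prop :=
  a ∈ E ∧ ∀ k, k ≤ b → ¬ Refutes E k a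

/-- The stage `a` enumerates a number, and no smaller number is enumerated later. -/
def IsTrueStage (E : Set M.carrier) (a : M.carrier) : Prop :=
  a ∈ E ∧ ∀ k, ¬ Refutes E k a

/-- The order on stages in which a stage lies below the later ones at which it appears to be true,
and above the other later ones. -/
def StageLE (E : Set M.carrier) (a b : M.carrier) : Prop :=
  a = b ∨ a < b ∧ AppearsTrue E a b ∨ b < a ∧ ¬ AppearsTrue E b a

/-- The set coding the order on stages. -/
def stageOrder (E : Set M.carrier) : Set M.carrier :=
  {p | ∃ a, a ≤ p ∧ ∃ b, b ≤ p ∧ (p = pr a b ∧ StageLE E a b)}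

theorem pr_mem_stageOrder {a b : M.carrier} : pr a b ∈ stageOrder E ↔ StageLE E a b := by
  constructor
  · rintro ⟨a', -, b', -, hp, h⟩
    obtain ⟨rfl, rfl⟩ := pr_inj hp
    exact h
  · exact fun h => ⟨a, left_le_pr a b, b, right_le_pr a b, rfl, h⟩

/-- Components are bounded by the code of the pair, so refutation is `Σ⁰₀`. -/
theorem refutes_iff {k a : M.carrier} : Refutes E k a ↔ a < k ∧ k ∈ E ∧
    ∃ w, w ≤ a ∧ ∃ x, x ≤ a ∧ ∃ w', w' ≤ k ∧ ∃ x', x' ≤ k ∧ (a = pr w x ∧ k = pr w' x' ∧ x' < x) := by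
  constructor
  · rintro ⟨hak, hk, w, x, w', x', rfl, rfl, h⟩
    exact ⟨hak, hk, w, left_le_pr _ _, x, right_le_pr _ _, w', left_le_pr _ _, x', right_le_pr _ _,
      rfl, rfl, h⟩
  · rintro ⟨hak, hk, w, -, x, -, w', -, x', -, h⟩
    exact ⟨hak, hk, w, x, w', x', h⟩

theorem sigma00Def_refutes {n : ℕ} (i j : Fin n) :
    Sigma00Def ![E] fun v => Refutes E (v i) (v j) := by
  simp only [refutes_iff]
  exact .and (.lt (.var _) (.var _)) (.and (.mem 0 (.var _))
    (.bex_le (.var _) (.bex_le (.var _) (.bex_le (.var _) (.bex_le (.var _)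
      (.and (.eq (.var _) (.pr (.var _) (.var _))) (.and (.eq (.var _) (.pr (.var _) (.var _)))
        (.lt (.var _) (.var _)))))))))

theorem sigma00Def_appearsTrue {n : ℕ} (i j : Fin n) :
    Sigma00Def ![E] fun v => AppearsTrue E (v i) (v j) :=
  .and (.mem 0 (.var _)) (.ball_le (.var _) (sigma00Def_refutes 0 i.succ).not)

theorem stageOrder_mem (hE : E ∈ M.sets) : stageOrder E ∈ M.sets :=
  sigma00_comprehension (V := ![E]) (by simpa using hE)
    (Q := fun p _ => ∃ a, a ≤ p ∧ ∃ b, b ≤ p ∧ (p = pr a b ∧ StageLE E a b))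
    (.bex_le (.var _) (.bex_le (.var _) (.and (.eq (.var _) (.pr (.var _) (.var _)))
      (.or (.eq (.var _) (.var _))
        (.or (.and (.lt (.var _) (.var _)) (sigma00Def_appearsTrue 1 0))
          (.and (.lt (.var _) (.var _)) (sigma00Def_appearsTrue 0 1).not)))))) ![]

theorem AppearsTrue.mono {a b c : M.carrier} (hbc : b ≤ c) (h : AppearsTrue E a c) :
    AppearsTrue E a b :=
  ⟨h.1, fun k hk => h.2 k (hk.trans hbc)⟩

/-- As `b` does not refute `a`, it enumerates a number at least as large as that of `a`. Whatever
refutes `a` after `b` therefore refutes `b` too. -/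
theorem AppearsTrue.trans (hE : ∀ a ∈ E, ∃ w x, a = pr w x) {a b c : M.carrier} (hab : a < b)
    (h : AppearsTrue E a b) (h' : AppearsTrue E b c) : AppearsTrue E a c := by
  refine ⟨h.1, fun k hk hka => ?_⟩
  rcases le_or_gt k b with hkb | hbk
  · exact h.2 k hkb hka
  · obtain ⟨-, hkE, w, x, w', x', rfl, rfl, hx⟩ := hka
    obtain ⟨w'', x'', rfl⟩ := hE b h'.1
    refine h'.2 _ hk ⟨hbk, hkE, w'', x'', w', x', rfl, rfl, hx.trans_le ?_⟩
    by_contra hcon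
    exact h.2 _ le_rfl ⟨hab, h'.1, w, x, w'', x'', rfl, rfl, not_le.1 hcon⟩

theorem StageLE.antisymm {a b : M.carrier} (h : StageLE E a b) (h' : StageLE E b a) : a = b := by
  rcases h with h | ⟨h, h1⟩ | ⟨h, h1⟩
  · exact h
  · rcases h' with h' | ⟨h', -⟩ | ⟨-, h2⟩
    · exact h'.symm
    · exact (lt_asymm h h').elim
    · exact (h2 h1).elim
  · rcases h' with h' | ⟨-, h2⟩ | ⟨h', -⟩
    · exact h'.symm
    · exact (h1 h2).elim
    · exact (lt_asymm h h').elim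

theorem StageLE.total (a b : M.carrier) : StageLE E a b ∨ StageLE E b a := by
  rcases lt_trichotomy a b with h | h | h
  · by_cases h' : AppearsTrue E a b
    · exact .inl (.inr (.inl ⟨h, h'⟩))
    · exact .inr (.inr (.inr ⟨h, h'⟩))
  · exact .inl (.inl h)
  · by_cases h' : AppearsTrue E b a
    · exact .inr (.inr (.inl ⟨h, h'⟩))
    · exact .inl (.inr (.inr ⟨h, h'⟩))

theorem StageLE.trans (hE : ∀ a ∈ E, ∃ w x, a = pr w x) {a b c : M.carrier}
    (h : StageLE E a b) (h' : StageLE E b c) : StageLE E a c := by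
  rcases h with rfl | ⟨hab, h1⟩ | ⟨hba, h1⟩
  · exact h'
  · rcases h' with rfl | ⟨hbc, h2⟩ | ⟨hcb, h2⟩
    · exact .inr (.inl ⟨hab, h1⟩)
    · exact .inr (.inl ⟨hab.trans hbc, h1.trans hE hab h2⟩)
    · rcases lt_trichotomy a c with hac | rfl | hca
      · exact .inr (.inl ⟨hac, h1.mono hcb.le⟩)
      · exact .inl rfl
      · exact .inr (.inr ⟨hca, fun h => h2 (h.trans hE hca h1)⟩)
  · rcases h' with rfl | ⟨hbc, h2⟩ | ⟨hcb, h2⟩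
    · exact .inr (.inr ⟨hba, h1⟩)
    · rcases lt_trichotomy a c with hac | rfl | hca
      · exact (h1 (h2.mono hac.le)).elim
      · exact (h1 h2).elim
      · exact .inr (.inr ⟨hca, fun h => h1 (h2.trans hE hbc h)⟩)
    · exact .inr (.inr ⟨hcb.trans hba, fun h => h2 (h.mono hba.le)⟩)

theorem isLinear_stageOrder (hE : ∀ a ∈ E, ∃ w x, a = pr w x) : IsLinear (stageOrder E) := by
  simp only [IsLinear, pr_mem_stageOrder]
  exact ⟨fun a b _ => ⟨.inl rfl, .inl rfl⟩, fun a b h => h.1.antisymm h.2,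
    fun a b c h => h.1.trans hE h.2, fun a b _ => StageLE.total a b⟩

/-- The sequence of the stages `(i + 1)² + (i + 1) + 1`, which are not codes of pairs. -/
theorem not_wellOrder_stageOrder (hE : ∀ a ∈ E, ∃ w x, a = pr w x) :
    ¬ M.Sat Fin.elim0 (Fin.cons (stageOrder E) Fin.elim0 : Fin 1 → Set M.carrier)
      (wellOrder 0) := by
  rw [sat_wellOrder]
  rintro ⟨-, h⟩
  refine h ⟨{p | ∃ i, i ≤ p ∧ p = pr i ((i + 1) * (i + 1) + (i + 1) + 1)},
    sigma00_comprehension (V := Fin.elim0) (fun i => i.elim0)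
      (Q := fun p _ => ∃ i, i ≤ p ∧ p = pr i ((i + 1) * (i + 1) + (i + 1) + 1))
      (.bex_le (.var _) (.eq (.var _) (.pr (.var _) (.add (.add (.mul (.add (.var _) .one)
        (.add (.var _) .one)) (.add (.var _) .one)) .one)))) ![], ⟨?_, ?_, ?_⟩, ?_⟩
  · rintro _ ⟨i, -, rfl⟩
    exact ⟨i, _, rfl, rfl, pr_mem_stageOrder.2 (.inl rfl)⟩
  · exact fun i _ => ⟨_, i, left_le_pr _ _, rfl⟩
  · rintro a b c ⟨⟨i, -, hi⟩, ⟨j, -, hj⟩⟩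
    obtain ⟨rfl, rfl⟩ := pr_inj hi
    obtain ⟨rfl, rfl⟩ := pr_inj hj
    rfl
  · rintro a b c ⟨⟨i, -, hi⟩, ⟨j, -, hj⟩⟩
    obtain ⟨rfl, rfl⟩ := pr_inj hi
    obtain ⟨rfl, rfl⟩ := pr_inj hj
    have hlt : (a + 1) * (a + 1) + (a + 1) + 1 < (a + 1 + 1) * (a + 1 + 1) + (a + 1 + 1) + 1 := by
      rw [← add_one_le_iff]
      have := le_add_left_self ((a + 1) * (a + 1) + (a + 1) + 1 + 1) (a + a + 1 + 1 + 1)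
      convert this using 1
      ring
    -- The earlier number is not in `E` and never appears true, so it lies above the later one.
    refine ⟨pr_mem_stageOrder.2 (.inr (.inr ⟨hlt, fun h => ?_⟩)), hlt.ne'⟩
    obtain ⟨w, x, hwx⟩ := hE _ h.1
    exact ne_pr _ _ _ hwx.symm

/-- A true stage lies below every later number. Any other number lies above all numbers from the
point where it ceases to appear true. -/
theorem setOf_isTrueStage_mem (hW : M.Satisfies weakWellOrdersAreWellOrders) (hES : E ∈ M.sets)
    (hE : ∀ a ∈ E, ∃ w x, a = pr w x) : {a | IsTrueStage E a} ∈ M.sets := by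
  refine setOf_mem_of_not_weakWellOrder (stageOrder_mem hES) (isLinear_stageOrder hE)
    (fun a => pr_mem_stageOrder.2 (.inl rfl)) ?_ ?_
    fun h => not_wellOrder_stageOrder hE (hW _ (stageOrder_mem hES) h)
  · intro z hz
    refine ⟨z, fun u hu => ?_⟩
    rcases pr_mem_stageOrder.1 hu with rfl | ⟨h, -⟩ | ⟨-, h⟩
    · exact le_rfl
    · exact h.le
    · exact (h ⟨hz.1, fun k _ => hz.2 k⟩).elim
  · intro z hz
    have : ∃ k, z ≤ k ∧ ¬ AppearsTrue E z k := by
      by_cases hzE : z ∈ E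
      · by_contra hcon
        push Not at hcon
        exact hz ⟨hzE, fun k hk => (hcon k hk.1.le).2 k le_rfl hk⟩
      · exact ⟨z, le_rfl, fun h => hzE h.1⟩
    obtain ⟨k, hzk, hk⟩ := this
    refine ⟨k, fun u hu => ?_⟩
    rcases pr_mem_stageOrder.1 hu with rfl | ⟨-, h⟩ | ⟨h, -⟩
    · exact hzk
    · exact le_of_not_gt fun hku => hk (h.mono hku.le)
    · exact h.le.trans hzk

/-- Among the stages from `N` on, one that enumerates the least possible number can never be
refuted. -/
theorem exists_isTrueStage (hES : E ∈ M.sets) (hE : ∀ a ∈ E, ∃ w x, a = pr w x) {N : M.carrier}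
    (hN : ∃ a ∈ E, N ≤ a) : ∃ w x, N ≤ pr w x ∧ IsTrueStage E (pr w x) := by
  obtain ⟨a, ha, hNa⟩ := hN
  obtain ⟨w, x, rfl⟩ := hE a ha
  obtain ⟨x, ⟨w, hwx, hN⟩, hmin⟩ := exists_min_snd (C := {p | p ∈ E ∧ N ≤ p})
    (sigma00_comprehension (V := ![E]) (by simpa using hES) (Q := fun p v => p ∈ E ∧ v 0 ≤ p)
      (.and (.mem 0 (.var _)) (.le (.var _) (.var _))) ![N]) ⟨w, ha, hNa⟩
  refine ⟨w, x, hN, hwx, ?_⟩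
  rintro _ ⟨hlt, hk, w₁, x₁, w', x', h1, rfl, hx'⟩
  obtain ⟨rfl, rfl⟩ := pr_inj h1
  exact absurd hx' (not_lt.2 (hmin x' w' ⟨hk, hN.trans hlt.le⟩))

theorem range_mem_of_unbounded (hW : M.Satisfies weakWellOrdersAreWellOrders) (hES : E ∈ M.sets)
    (hE : ∀ a ∈ E, ∃ w x, a = pr w x) (hinj : ∀ w w' x, pr w x ∈ E → pr w' x ∈ E → w = w')
    (hunb : ∀ N, ∃ a ∈ E, N ≤ a) : {x | ∃ w, pr w x ∈ E} ∈ M.sets := by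
  set T := {a | IsTrueStage E a} with hTdef
  have hT : T ∈ M.sets := setOf_isTrueStage_mem hW hES hE
  -- The next true stage cannot enumerate a smaller number, as the current one is true, nor the same
  -- number, by injectivity.
  have hlarge : ∀ x, ∃ z, ∃ w, w ≤ z ∧ ∃ y, y ≤ z ∧ (pr w y ∈ T ∧ x ≤ y) := by
    intro x
    refine sigma01_induction (V := ![T]) (by simpa using hT)
      (Q := fun z x _ => ∃ w, w ≤ z ∧ ∃ y, y ≤ z ∧ (pr w y ∈ T ∧ x ≤ y))
      (.bex_le (.var _) (.bex_le (.var _) (.and (.mem 0 (.pr (.var _) (.var _)))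
        (.le (.var _) (.var _))))) ![] ?_ ?_ x
    · obtain ⟨w, y, -, h⟩ := exists_isTrueStage hES hE (hunb 0)
      exact ⟨max w y, w, le_max_left _ _, y, le_max_right _ _, h, Model.zero_le _⟩
    · rintro x ⟨-, w, -, y, -, hT, hxy⟩
      obtain ⟨w', y', hN, h⟩ := exists_isTrueStage hES hE (hunb (pr w y + 1))
      refine ⟨max w' y', w', le_max_left _ _, y', le_max_right _ _, h, add_one_le_iff.2 ?_⟩
      refine hxy.trans_lt (lt_of_le_of_ne ?_ ?_)
      · by_contra hcon
        exact hT.2 _ ⟨add_one_le_iff.1 hN, h.1, w, y, w', y', rfl, rfl, not_le.1 hcon⟩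
      · rintro rfl
        obtain rfl := hinj _ _ _ hT.1 h.1
        exact absurd (add_one_le_iff.1 hN) (lt_irrefl _)
  have hiff : ∀ x w y, pr w y ∈ T → x < y → ((∃ w', pr w' x ∈ E) ↔
      ∃ w', w' ≤ pr w y ∧ pr w' x ∈ E) := by
    refine fun x w y hT hxy => ⟨fun ⟨w', h⟩ => ⟨w', ?_, h⟩, fun ⟨w', _, h⟩ => ⟨w', h⟩⟩
    -- A witness `w'` beyond the true stage would give a later stage `pr w' x ≥ w'` enumerating `x <
    -- y`.
    by_contra hcon
    exact hT.2 _ ⟨(not_le.1 hcon).trans_le (left_le_pr _ _), h, w, y, w', x, rfl, rfl, hxy⟩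
  -- All true stages enumerating some `y > x` give the same verdict on `x`, and one exists; so
  -- "some" and "every" agree.
  have := delta01_comprehension (V := ![T, E]) (by simp [Fin.forall_fin_two, hT, hES])
    (Q := fun z x _ => ∃ w, w ≤ z ∧ ∃ y, y ≤ z ∧ (pr w y ∈ T ∧ x < y ∧
      ∃ w', w' ≤ pr w y ∧ pr w' x ∈ E))
    (R := fun z x _ => ∀ w, w ≤ z → ∀ y, y ≤ z → (pr w y ∈ T → x < y →
      ∃ w', w' ≤ pr w y ∧ pr w' x ∈ E))
    (.bex_le (.var _) (.bex_le (.var _) (.and (.mem 0 (.pr (.var _) (.var _)))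
      (.and (.lt (.var _) (.var _)) (.bex_le (.pr (.var _) (.var _))
        (.mem 1 (.pr (.var _) (.var _))))))))
    (.ball_le (.var _) (.ball_le (.var _) (.imp (.mem 0 (.pr (.var _) (.var _)))
      (.imp (.lt (.var _) (.var _)) (.bex_le (.pr (.var _) (.var _))
        (.mem 1 (.pr (.var _) (.var _)))))))) ![] ?_
  · convert this using 2
    ext x
    constructor
    · intro h
      obtain ⟨z, w, hw, y, hy, hT, hxy⟩ := hlarge (x + 1)
      rw [add_one_le_iff] at hxy
      exact ⟨z, w, hw, y, hy, hT, hxy, (hiff x w y hT hxy).1 h⟩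
    · rintro ⟨z, w, -, y, -, hT, hxy, h⟩
      exact (hiff x w y hT hxy).2 h
  · intro x
    constructor
    · rintro ⟨z, w, -, y, -, hT, hxy, h⟩ m w₁ - y₁ - hT₁ hxy₁
      exact (hiff x w₁ y₁ hT₁ hxy₁).1 ((hiff x w y hT hxy).2 h)
    · intro h
      obtain ⟨z, w, hw, y, hy, hT, hxy⟩ := hlarge (x + 1)
      rw [add_one_le_iff] at hxy
      exact ⟨z, w, hw, y, hy, hT, hxy, h z w hw y hy hT hxy⟩

end TrueStages

/-! ### Arithmetical comprehension -/

section Comprehension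

variable [hM : M.IsRCA0]

theorem projection_mem (hW : M.Satisfies weakWellOrdersAreWellOrders) {S : Set M.carrier}
    (hS : S ∈ M.sets) : {x | ∃ w, pr w x ∈ S} ∈ M.sets := by
  set E : Set M.carrier := {p | p ∈ S ∧ ∃ w, w ≤ p ∧ ∃ x, x ≤ p ∧ (p = pr w x ∧
    ∀ w', w' < w → pr w' x ∉ S)} with hEdef
  have hES : E ∈ M.sets := sigma00_comprehension (V := ![S]) (by simpa using hS)
    (Q := fun p _ => p ∈ S ∧ ∃ w, w ≤ p ∧ ∃ x, x ≤ p ∧ (p = pr w x ∧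
      ∀ w', w' < w → pr w' x ∉ S))
    (.and (.mem 0 (.var _)) (.bex_le (.var _) (.bex_le (.var _)
      (.and (.eq (.var _) (.pr (.var _) (.var _)))
        (.ball (.var _) (.not (.mem 0 (.pr (.var _) (.var _))))))))) ![]
  have hmem : ∀ w x, pr w x ∈ E ↔ pr w x ∈ S ∧ ∀ w', w' < w → pr w' x ∉ S := by
    refine fun w x => ⟨?_, fun h => ⟨h.1, w, left_le_pr _ _, x, right_le_pr _ _, rfl, h.2⟩⟩
    rintro ⟨h, w₁, -, x₁, -, hp, h'⟩
    obtain ⟨rfl, rfl⟩ := pr_inj hp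
    exact ⟨h, h'⟩
  have hproj : {x | ∃ w, pr w x ∈ S} = {x | ∃ w, pr w x ∈ E} := by
    ext x
    refine ⟨?_, fun ⟨w, h⟩ => ⟨w, h.1⟩⟩
    rintro ⟨w, hw⟩
    by_contra hcon
    -- If `x` had no least witness, induction on `n` would exclude all witnesses below `n`.
    have := sigma00_induction (V := ![S]) (by simpa using hS)
      (Q := fun n v => ∀ w, w < n → pr w (v 0) ∉ S)
      (.ball (.var _) (.not (.mem 0 (.pr (.var _) (.var _))))) ![x]
      (fun w hw => (Model.not_lt_zero w hw).elim)
      (fun n ih w hw hwS => by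
        rcases Model.lt_succ.1 hw with hw | rfl
        · exact ih w hw hwS
        · exact hcon ⟨w, (hmem _ _).2 ⟨hwS, ih⟩⟩) (w + 1)
    exact this w (lt_add_one_self w) hw
  have hE : ∀ a ∈ E, ∃ w x, a = pr w x := fun a ⟨_, w, _, x, _, h, _⟩ => ⟨w, x, h⟩
  have hinj : ∀ w w' x, pr w x ∈ E → pr w' x ∈ E → w = w' := by
    intro w w' x h h'
    rw [hmem] at h h'
    exact le_antisymm (not_lt.1 fun hlt => h.2 _ hlt h'.1) (not_lt.1 fun hlt => h'.2 _ hlt h.1)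
  rw [hproj]
  by_cases hunb : ∀ N, ∃ a ∈ E, N ≤ a
  · exact range_mem_of_unbounded hW hES hE hinj hunb
  · push Not at hunb
    obtain ⟨N, hN⟩ := hunb
    -- If `E` is bounded by `N`, the search for a witness is bounded as well.
    have := sigma00_comprehension (V := ![E]) (by simpa using hES)
      (Q := fun x v => ∃ w, w < v 0 ∧ pr w x ∈ E)
      (.bex (.var _) (.mem 0 (.pr (.var _) (.var _)))) ![N]
    convert this using 2
    ext x
    exact ⟨fun ⟨w, h⟩ => ⟨w, (left_le_pr _ _).trans_lt (hN _ h), h⟩, fun ⟨w, _, h⟩ => ⟨w, h⟩⟩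

end Comprehension

/-! ### Coding tuples, and induction on arithmetical formulas. -/

section Tuples

/-- The code of a tuple, as a term. -/
def _root_.SOA.Term.tuple : (n : ℕ) → Term n
  | 0 => 0
  | n + 1 => pair (.var 0) (Term.tuple n).lift

/-- The code of a tuple. -/
def tuple {n : ℕ} (v : Fin n → M.carrier) : M.carrier := M.val v (Term.tuple n)

theorem tuple_cons {n : ℕ} (a : M.carrier) (v : Fin n → M.carrier) :
    tuple (Fin.cons a v : Fin (n + 1) → M.carrier) = pr a (tuple v) := by
  change pr a (M.val (Fin.cons a v : Fin (n + 1) → M.carrier) (Term.tuple n).lift) = _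
  rw [val_lift]
  rfl

theorem TermDef.comp_init {n : ℕ} {t : (Fin n → M.carrier) → M.carrier} (ht : TermDef t) :
    TermDef fun v : Fin (n + 1) → M.carrier => t (Fin.init v) := by
  obtain ⟨τ, hτ⟩ := ht
  exact ⟨τ.subst fun i => .var i.castSucc, fun v => by rw [val_subst]; exact hτ _⟩

variable [hM : M.IsRCA0]

theorem tuple_injective {n : ℕ} : Function.Injective (tuple (M := M) (n := n)) := by
  induction n with
  | zero => exact fun v w _ => Subsingleton.elim v w
  | succ n ih =>
    intro v w h
    rw [← Fin.cons_self_tail v, ← Fin.cons_self_tail w, tuple_cons, tuple_cons] at h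
    rw [← Fin.cons_self_tail v, ← Fin.cons_self_tail w, (pr_inj h).1, ih (pr_inj h).2]

theorem le_tuple {n : ℕ} (v : Fin n → M.carrier) (i : Fin n) : v i ≤ tuple v := by
  induction n with
  | zero => exact i.elim0
  | succ n ih =>
    rw [← Fin.cons_self_tail v, tuple_cons]
    refine Fin.cases ?_ (fun i => ?_) i
    · exact left_le_pr _ _
    · exact (ih (Fin.tail v) i).trans (right_le_pr _ _)

/-- Induction on `n`, binding the variables one by one from the front. The bound `c` comes last so
that it stays free throughout. -/
theorem setOf_exists_snoc_mem {n k : ℕ} {V : Fin k → Set M.carrier} (hV : ∀ i, V i ∈ M.sets)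
    {P : (Fin (n + 1) → M.carrier) → Prop} (hP : Sigma00Def V P) :
    {c | ∃ v : Fin n → M.carrier, (∀ i, v i ≤ c) ∧
      P (Fin.snoc v c : Fin (n + 1) → M.carrier)} ∈ M.sets := by
  induction n with
  | zero =>
    have := sigma00_comprehension hV (n := 0) (Q := fun x _ => P fun _ => x) (by
      convert hP using 3 with v
      funext i
      exact congrArg v (Fin.eq_zero i).symm) ![]
    convert this using 2
    ext c
    have : ∀ v : Fin 0 → M.carrier, (Fin.snoc v c : Fin 1 → M.carrier) = fun _ => c := by
      intro v
      funext i
      obtain rfl : i = Fin.last 0 := Fin.eq_zero i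
      rw [Fin.snoc_last]
    simp [this]
  | succ n ih =>
    have h := ih (P := fun u => ∃ a, a ≤ u (Fin.last n) ∧ P (Fin.cons a u : Fin (n + 2) → _))
      (.bex_le (.var _) (by
        convert hP using 3 with v
        exact Fin.cons_self_tail v))
    convert h using 2
    ext c
    simp only [Fin.snoc_last]
    constructor
    · rintro ⟨v, hv, h⟩
      refine ⟨Fin.tail v, fun i => hv _, v 0, hv _, ?_⟩
      rwa [Fin.cons_snoc_eq_snoc_cons, Fin.cons_self_tail]
    · rintro ⟨v, hv, a, ha, h⟩
      refine ⟨Fin.cons a v, Fin.cases ha hv, ?_⟩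
      rwa [← Fin.cons_snoc_eq_snoc_cons]

/-- Decoding is a bounded search, because the components of a tuple are at most its code. -/
theorem setOf_tuple_mem {n k : ℕ} {V : Fin k → Set M.carrier} (hV : ∀ i, V i ∈ M.sets)
    {P : (Fin n → M.carrier) → Prop}
    (hP : Sigma00Def V fun v : Fin (n + 1) → M.carrier => P (Fin.init v)) :
    ∃ S ∈ M.sets, ∀ v : Fin n → M.carrier, tuple v ∈ S ↔ P v := by
  have ht : TermDef (M := M) (n := n) tuple := ⟨Term.tuple n, fun _ => rfl⟩
  refine ⟨_, setOf_exists_snoc_mem hV (.and (.eq (.var (Fin.last n)) ht.comp_init) hP),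
    fun v => ?_⟩
  simp only [Set.mem_ofPred_eq, Fin.snoc_last, Fin.init_snoc]
  constructor
  · rintro ⟨w, -, h, hw⟩
    rwa [tuple_injective h]
  · exact fun h => ⟨v, le_tuple v, rfl, h⟩

theorem compl_mem {S : Set M.carrier} (hS : S ∈ M.sets) : Sᶜ ∈ M.sets :=
  sigma00_comprehension (V := ![S]) (by simpa using hS) (Q := fun x _ => ¬ x ∈ S)
    (.not (.mem 0 (.var _))) ![]

theorem inter_mem {S T : Set M.carrier} (hS : S ∈ M.sets) (hT : T ∈ M.sets) : S ∩ T ∈ M.sets :=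
  sigma00_comprehension (V := ![S, T]) (by simp [Fin.forall_fin_two, hS, hT])
    (Q := fun x _ => x ∈ S ∧ x ∈ T) (.and (.mem 0 (.var _)) (.mem 1 (.var _))) ![]

/-- Arithmetical formulas define sets of codes of tuples. -/
theorem exists_tuple_mem_iff_sat (hW : M.Satisfies weakWellOrdersAreWellOrders) {n k : ℕ}
    {φ : Formula n k} (hφ : φ.IsArithmetical) (V : Fin k → Set M.carrier)
    (hV : ∀ i, V i ∈ M.sets) :
    ∃ S ∈ M.sets, ∀ v : Fin n → M.carrier, tuple v ∈ S ↔ M.Sat v V φ := by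
  have hval : ∀ {n : ℕ} (t : Term n), TermDef (fun v => M.val v t) := fun t => ⟨t, fun _ => rfl⟩
  induction hφ with
  | eq s t => exact setOf_tuple_mem hV (.eq (hval s).comp_init (hval t).comp_init)
  | lt s t => exact setOf_tuple_mem hV (.lt (hval s).comp_init (hval t).comp_init)
  | mem t X => exact setOf_tuple_mem hV (.mem X (hval t).comp_init)
  | not _ ih =>
    obtain ⟨S, hS, h⟩ := ih V hV
    exact ⟨Sᶜ, compl_mem hS, fun v => not_congr (h v)⟩
  | and _ _ ih₁ ih₂ =>
    obtain ⟨S, hS, h⟩ := ih₁ V hV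
    obtain ⟨T, hT, h'⟩ := ih₂ V hV
    exact ⟨S ∩ T, inter_mem hS hT, fun v => and_congr (h v) (h' v)⟩
  | or _ _ ih₁ ih₂ =>
    obtain ⟨S, hS, h⟩ := ih₁ V hV
    obtain ⟨T, hT, h'⟩ := ih₂ V hV
    refine ⟨(Sᶜ ∩ Tᶜ)ᶜ, compl_mem (inter_mem (compl_mem hS) (compl_mem hT)), fun v => ?_⟩
    simp only [Set.mem_compl_iff, Set.mem_inter_iff, h, h', Sat]
    tauto
  | imp _ _ ih₁ ih₂ =>
    obtain ⟨S, hS, h⟩ := ih₁ V hV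
    obtain ⟨T, hT, h'⟩ := ih₂ V hV
    refine ⟨(S ∩ Tᶜ)ᶜ, compl_mem (inter_mem hS (compl_mem hT)), fun v => ?_⟩
    simp only [Set.mem_compl_iff, Set.mem_inter_iff, h, h', Sat]
    tauto
  | all _ ih =>
    obtain ⟨S, hS, h⟩ := ih V hV
    -- The bound variable is the first component of the code, so its existential quantifier is a
    -- projection.
    refine ⟨_, compl_mem (projection_mem hW (compl_mem hS)), fun v => ?_⟩
    simp only [Set.mem_compl_iff, Set.mem_ofPred_eq, ← tuple_cons, h, Sat, not_exists, not_not]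
  | ex _ ih =>
    obtain ⟨S, hS, h⟩ := ih V hV
    refine ⟨_, projection_mem hW hS, fun v => ?_⟩
    simp only [Set.mem_ofPred_eq, ← tuple_cons, h, Sat]

theorem satisfies_arithmeticalComprehension (hW : M.Satisfies weakWellOrdersAreWellOrders)
    {φ : Sentence} (hφ : φ ∈ ArithmeticalComprehension) : M.Satisfies φ := by
  obtain ⟨hφ⟩ := hφ
  rename_i n k φ
  rw [satisfies_close]
  intro V hV v
  obtain ⟨S, hS, h⟩ := exists_tuple_mem_iff_sat hW hφ V hV
  -- The required set is the section of `S` at the code of the parameters.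
  refine ⟨_, sigma00_comprehension (V := ![S]) (by simpa using hS)
    (Q := fun x u => pr x (u 0) ∈ S) (.mem 0 (.pr (.var _) (.var _))) ![tuple v], fun x => ?_⟩
  have := h (Fin.cons x v)
  rw [tuple_cons] at this
  simp only [Formula.iff, Sat, sat_subst, Fin.cons_succ]
  exact ⟨this.1, this.2⟩

end Tuples

end Model
end SOA

theorem mainTheorem9 (φ : SOA.Sentence) (hφ : φ ∈ SOA.ArithmeticalComprehension) :
    SOA.Entails.{u} (SOA.RCA0 ∪ {SOA.weakWellOrdersAreWellOrders}) φ := by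
  intro M hM
  have : M.IsRCA0 := ⟨fun ψ hψ => hM ψ (.inl hψ)⟩
  exact SOA.Model.satisfies_arithmeticalComprehension (hM _ (.inr rfl)) hφ
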